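/- Let $\mathbb T=\mathbb R/\mathbb Z$. For $\alpha\in\mathbb R$ and a continuous $f:\mathbb T\to\mathbb R$ let $T_f(x,t)=(x+\alpha,\,t+f(x))$ on $\mathbb T\times\mathbb R$, and for $m\in\mathbb Z$ let $f^{(m)}(x)$ be the second coordinate of $T_f^m(x,0)$. The orbit of $p$ is $\{T_f^m p: m\in\mathbb Z\}$; it is called discrete if it is a closed and discrete subset of $\mathbb T\times\mathbb R$. $T_f$ is transitive if some orbit is dense, and Besicovitch if it is transitive and has a discrete orbit. Let $\mathcal D$ be the set of $x\in\mathbb T$ such that the orbit of $(x,t)$ is discrete for every $t\in\mathbb R$. Theorem. For every irrational $\alpha$ there is a continuous $f:\mathbb T\to\mathbb R$ with $\int_{\mathbb T} f=0$ such that $T_f$ is Besicovitch, the set of points with discrete orbits equals $\mathcal D\times\mathbb R$, and this set has Hausdorff dimension $2$. Moreover, $f$ can be taken of the following form. Let $q_0,q_1,\dots$ be the denominators of the continued-fraction convergents of $\alpha$. There are indices $k_1<k_2<\cdots$, all even or all odd, with $q_{k_1+1}\ge 9$, $q_{k_{n+1}}\ge 5q_{k_n}$ and $q_{k_{n+1}+1}\ge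 5q_{k_n+1}$ for $n\ge1$, and $\frac1n\log q_{k_n}\to\infty$, such that, with $$A_n=\lfloor (3/4)^n q_{k_n+1}\rfloor,\qquad Q_n=q_{k_n}A_n,\qquad L_n=\frac{q_{k_n}q_{k_n+1}}{n^2},$$ and with $f_n:\mathbb R\to\mathbb R$ the even $1/Q_n$-periodic function given by $$f_n(x)=\begin{cases}0,&0\le x\le \frac1{12Q_n},\\ L_n\bigl(x-\frac1{12Q_n}\bigr),&\frac1{12Q_n}\le x\le\frac5{12Q_n},\\ \frac{L_n}{3Q_n},&\frac5{12Q_n}\le x\le\frac1{2Q_n},\end{cases}$$ one has $f(x)=\sum_{n\ge1}\bigl(f_n(x+\alpha)-f_n(x)\bigr)$ with uniform convergence in $x\in\mathbb R$, and the following holds. Put $I^{++}=[-\frac1{12},\frac1{12}]$, $I^{-+}=[\frac16,\frac13]$, $I^{--}=[\frac5{12},\frac7{12}]$, $I^{+-}=[\frac23,\frac56]$, and for $s_-,s_+\in\{+,-\}$ let $$F^{s_-s_+}=\bigcap_{n\ge1}\ \bigcup_{j=0}^{Q_n-1}\frac{I^{s_-s_+}+j}{Q_n}\pmod 1 .$$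 Then, for all $s_-,s_+$, $F^{s_-s_+}\subset\mathcal D$, $\dim_H F^{s_-s_+}=1$, and for every $x\in F^{s_-s_+}$, as $m\to\pm\infty$ (with the corresponding sign $s_\pm$), $f^{(m)}(x)\to s_\pm\infty$ if $s_-=s_+$, and $f^{(m)}(x)\to(-1)^{k_1}s_\pm\infty$ if $s_-\ne s_+$. -/

import Mathlib

open Set Filter Topology MeasureTheory

noncomputable section

/-- The cylindrical transformation `T_f (x, t) = (x + a, t + f x)` over the rotation by `a` of the
circle `𝕋 = ℝ / ℤ`, as a homeomorphism of `𝕋 × ℝ`. -/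
def cylinderMap (a : UnitAddCircle) (f : C(UnitAddCircle, ℝ)) :
    (UnitAddCircle × ℝ) ≃ₜ (UnitAddCircle × ℝ) where
  toFun p := (p.1 + a, p.2 + f p.1)
  invFun p := (p.1 - a, p.2 - f (p.1 - a))
  left_inv p := by ext <;> simp
  right_inv p := by ext <;> simp
  continuous_toFun := by fun_prop
  continuous_invFun := by fun_prop

/-- The full (two-sided) orbit of a point under a homeomorphism. -/
def fullOrbit {X : Type*} [TopologicalSpace X] (T : X ≃ₜ X) (p : X) : Set X :=
  Set.range fun m : ℤ => (T ^ m) p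

/-- The orbit of `p` is discrete, i.e. closed and discrete. -/
def HasDiscreteOrbit {X : Type*} [TopologicalSpace X] (T : X ≃ₜ X) (p : X) : Prop :=
  IsClosed (fullOrbit T p) ∧ IsDiscrete (fullOrbit T p)

/-- Transitivity: some orbit is dense. -/
def IsTransitiveHomeo {X : Type*} [TopologicalSpace X] (T : X ≃ₜ X) : Prop :=
  ∃ p, Dense (fullOrbit T p)

/-- Besicovitch transformations: transitive, with at least one discrete orbit. -/
def IsBesicovitch {X : Type*} [TopologicalSpace X] (T : X ≃ₜ X) : Prop :=
  IsTransitiveHomeo T ∧ ∃ p, HasDiscreteOrbit T p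

/-- The set `𝒟` of those `x` in the circle such that the orbit of `(x, t)` is discrete for
every `t`. -/
def discreteBase (a : UnitAddCircle) (f : C(UnitAddCircle, ℝ)) : Set UnitAddCircle :=
  {x | ∀ t : ℝ, HasDiscreteOrbit (cylinderMap a f) (x, t)}

/-- The ergodic sums `f^(m)` of `f` over the rotation by `a`, for `m : ℤ`. -/
def ergodicSum (a : UnitAddCircle) (f : UnitAddCircle → ℝ) : ℤ → UnitAddCircle → ℝ
  | Int.ofNat n, x => ∑ i ∈ Finset.range n, f (x + i • a)
  | Int.negSucc n, x => -∑ i ∈ Finset.range (n + 1), f (x - (i + 1) • a)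

/-- The denominator `q_n` of the `n`-th convergent of the continued fraction of `α`. -/
def cfDen (α : ℝ) (n : ℕ) : ℝ := (GenContFract.of α).dens n

/-- The growth and parity conditions on the indices `k 1 < k 2 < ⋯` of the chosen convergents
(the value `k 0` is not used). -/
structure AdmissibleIndices (α : ℝ) (k : ℕ → ℕ) : Prop where
  increasing : ∀ n, 1 ≤ n → k n < k (n + 1)
  start : 9 ≤ cfDen α (k 1 + 1)
  growth : ∀ n, 1 ≤ n → 5 * cfDen α (k n) ≤ cfDen α (k (n + 1))
  growth_succ : ∀ n, 1 ≤ n → 5 * cfDen α (k n + 1) ≤ cfDen α (k (n + 1) + 1)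
  superexponential : Tendsto (fun n : ℕ => Real.log (cfDen α (k n)) / n) atTop atTop
  parity : (∀ n, 1 ≤ n → Even (k n)) ∨ (∀ n, 1 ≤ n → Odd (k n))

/-- `A_n = ⌊(3/4)^n q_{k_n + 1}⌋`. -/
def multA (α : ℝ) (k : ℕ → ℕ) (n : ℕ) : ℕ := ⌊(3 / 4 : ℝ) ^ n * cfDen α (k n + 1)⌋₊

/-- `Q_n = q_{k_n} A_n`, the reciprocal of the period of `f_n`. -/
def freqQ (α : ℝ) (k : ℕ → ℕ) (n : ℕ) : ℝ := cfDen α (k n) * multA α k n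

/-- `L_n = q_{k_n} q_{k_n + 1} / n^2`, the Lipschitz constant of `f_n`. -/
def lipL (α : ℝ) (k : ℕ → ℕ) (n : ℕ) : ℝ :=
  cfDen α (k n) * cfDen α (k n + 1) / (n : ℝ) ^ 2

/-- The even, `1 / Q`-periodic function on `ℝ` which on `[0, 1 / (2 Q)]` is `0` up to `1 / (12 Q)`,
has slope `L` on `[1 / (12 Q), 5 / (12 Q)]`, and is constant from `5 / (12 Q)` on. Here `d` is the
distance of `x` to the nearest multiple of `1 / Q`. -/
def trapezoid (L Q x : ℝ) : ℝ :=
  let d : ℝ := |Q * x - round (Q * x)| / Q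
  if d ≤ 1 / (12 * Q) then 0
  else if d ≤ 5 / (12 * Q) then L * (d - 1 / (12 * Q))
  else L / (3 * Q)

/-- The building block `f_n`, for `n ≥ 1`. -/
def blockFun (α : ℝ) (k : ℕ → ℕ) (n : ℕ) (x : ℝ) : ℝ :=
  trapezoid (lipL α k n) (freqQ α k n) x

/-- The interval, in units of `1 / Q_n`, from which `F^{s₋ s₊}_{n,0}` is built
(`true` stands for `+`, `false` for `-`; the first argument is `s₋`, the second `s₊`). -/
def unitInterval4 : Bool → Bool → Set ℝ
  | true, true => Icc (-1 / 12) (1 / 12)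
  | false, true => Icc (1 / 6) (1 / 3)
  | false, false => Icc (5 / 12) (7 / 12)
  | true, false => Icc (2 / 3) (5 / 6)

/-- The set `F^{s₋ s₊} = ⋂_{n ≥ 1} ⋃_{0 ≤ j < Q_n} F^{s₋ s₊}_{n,j}` in the circle. -/
def setF (α : ℝ) (k : ℕ → ℕ) (sm sp : Bool) : Set UnitAddCircle :=
  {x | ∀ n : ℕ, 1 ≤ n → ∃ j : ℕ, (j : ℝ) < freqQ α k n ∧
    ∃ u ∈ unitInterval4 sm sp, x = (((u + j) / freqQ α k n : ℝ) : UnitAddCircle)}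

/-- The number `±1` of a sign. -/
def signVal (s : Bool) : ℝ := if s then 1 else -1

/-- The sign with which the ergodic sums diverge on `F^{s₋ s₊}` in the time direction `±` that
carries the sign `s`: it is `s` if `s₋ = s₊`, and `(-1)^{k_1} s` otherwise. -/
def divergenceSign (k : ℕ → ℕ) (sm sp s : Bool) : ℝ :=
  if sm = sp then signVal s else (-1) ^ (k 1) * signVal s

end

/-!
All chosen convergents have even index, and their denominators grow as fast as desired. With
`h_n = L_n / Q_n` and a fixed profile `φ` on the circle the building blocks are
`f_n (x) = h_n φ (Q_n x)`. As `Q_n` is a multiple of `q_{k_n}`, the rotation by `α` moves `Q_n x` on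
the circle by a small positive angle `θ_n`, comparable to `(3 / 4) ^ n`, while `h_n` is comparable
to `(4 / 3) ^ n / n ^ 2` and `h_n θ_n` to `1 / n ^ 2` (`BlockScales`). Hence the coboundaries
`f_n (x + α) - f_n (x)` are uniformly summable, and the ergodic sums telescope:
`f^(m) (x) = ∑ h_n (φ (Q_n x + m θ_n) - φ (Q_n x))` (`hasSum_ergodicSum_blocks`).

Divergence. If all `Q_n x` lie on the minimum of `φ`, every summand is nonnegative, and the summand
for which `(4 / 3) ^ n` is comparable to `m` is at least a constant times `(4 / 3) ^ n / n ^ 2`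
(`BlockScales.le_of_hasSum_at_min`). If all `Q_n x` lie on the rising slope, let `N` be the first
block that is still on its slope at time `m`, so that `m` is comparable to `(4 / 3) ^ N`. The blocks
from `N` on contribute at least `∑_{n ≥ N} m / (2 n ^ 2)`, of order `m / N`, which beats the total
height `∑_{n < N} h_n`, of order `m / N ^ 2`, of the earlier ones
(`BlockScales.le_of_hasSum_at_slope`). The other two sign patterns follow by symmetries of `φ`.
Divergence of the ergodic sums makes the orbit discrete (`hasDiscreteOrbit_of_tendsto`).

Transitivity. At a large time `m` the sum `f^(m)` is large at a point of `F^{++}` and very negative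
at a point of `F^{--}`, so by connectedness it takes any prescribed value `e`. If moreover `m α` is
close to `0` modulo `1`, the cocycle identity spreads values close to `e` along the rotation, hence
to every part of the circle. So iterates of any open set meet any other one, and Baire's theorem
gives a dense orbit (`isTransitiveHomeo_cylinderMap`).

Dimension. Each set `F` contains a Cantor set parametrized by `[0, 1)`: the mixed radix digits of
`y` select, in each interval of one generation, an interval of the next. Because `Q_n` grows
superexponentially, the inverse of the parametrization is Hölder continuous with every exponent
`s < 1` (`exists_cantorPoint_bound`). This gives dimension at least `1`; multiplying by the identity
of `[0, 1)` gives dimension at least `2` for the product with `ℝ`, without any product formula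
(`le_dimH_of_holder_inverse`).
-/

noncomputable section

/-! ### Convergents of an irrational number -/

lemma not_terminatedAt_of_irrational {α : ℝ} (hα : Irrational α) (n : ℕ) :
    ¬(GenContFract.of α).TerminatedAt n := by
  intro h
  obtain ⟨q, hq⟩ := GenContFract.exists_rat_eq_of_terminates (v := α) ⟨n, h⟩
  exact hα ⟨q, hq.symm⟩

lemma exists_int_eq_contsAux (α : ℝ) (n : ℕ) :
    (∃ a b : ℤ, ((GenContFract.of α).contsAux n).a = a ∧
      ((GenContFract.of α).contsAux n).b = b) ∧
    (∃ a b : ℤ, ((GenContFract.of α).contsAux (n + 1)).a = a ∧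
      ((GenContFract.of α).contsAux (n + 1)).b = b) := by
  induction n with
  | zero =>
    refine ⟨⟨1, 0, by simp [GenContFract.contsAux]⟩, ⟨⌊α⌋, 1, ?_, ?_⟩⟩ <;>
      simp [GenContFract.contsAux, GenContFract.of_h_eq_floor]
  | succ n ih =>
    obtain ⟨⟨a, b, ha, hb⟩, ⟨a', b', ha', hb'⟩⟩ := ih
    refine ⟨⟨a', b', ha', hb'⟩, ?_⟩
    rcases hs : (GenContFract.of α).s.get? n with _ | gp
    · exact ⟨a', b', by rw [GenContFract.contsAux, hs]; simpa using ha',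
        by rw [GenContFract.contsAux, hs]; simpa using hb'⟩
    · have h1 : gp.a = 1 := GenContFract.of_partNum_eq_one (GenContFract.partNum_eq_s_a hs)
      obtain ⟨z, hz⟩ := GenContFract.exists_int_eq_of_partDen (GenContFract.partDen_eq_s_b hs)
      rw [GenContFract.contsAux_recurrence hs rfl rfl]
      refine ⟨z * a' + a, z * b' + b, ?_, ?_⟩ <;> simp [h1, hz, ha, hb, ha', hb']

lemma fib_le_cfDen {α : ℝ} (hα : Irrational α) (n : ℕ) : (Nat.fib (n + 1) : ℝ) ≤ cfDen α n :=
  GenContFract.succ_nth_fib_le_of_nth_den (Or.inr (not_terminatedAt_of_irrational hα _))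

lemma one_le_cfDen {α : ℝ} (hα : Irrational α) (n : ℕ) : 1 ≤ cfDen α n :=
  le_trans (by exact_mod_cast Nat.fib_pos.2 n.succ_pos) (fib_le_cfDen hα n)

lemma cfDen_mono (α : ℝ) : Monotone (cfDen α) :=
  monotone_nat_of_le_succ fun _ => GenContFract.of_den_mono

lemma tendsto_cfDen {α : ℝ} (hα : Irrational α) : Tendsto (cfDen α) atTop atTop := by
  have h : Tendsto (fun n => (Nat.fib (n + 1) : ℝ)) atTop atTop := by
    refine tendsto_natCast_atTop_atTop.comp (tendsto_atTop_mono' atTop ?_ (tendsto_add_atTop_nat 1))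
    filter_upwards [eventually_ge_atTop 5] with n hn
    exact Nat.le_fib_self (by omega)
  exact tendsto_atTop_mono (fib_le_cfDen hα) h

/-- An even-indexed convergent `p / q` lies below `α`, with `q α - p` comparable to the reciprocal
of the next denominator. -/
lemma exists_convergent_of_even {α : ℝ} (hα : Irrational α) {n : ℕ} (hn : Even n) :
    ∃ (p : ℤ) (q : ℕ), cfDen α n = q ∧ 1 / (2 * cfDen α (n + 1)) ≤ α * q - p ∧
      α * q - p ≤ 1 / cfDen α (n + 1) := by
  obtain ⟨a, b, ha, hb⟩ := (exists_int_eq_contsAux α n).2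
  have hB1 : 1 ≤ cfDen α n := one_le_cfDen hα n
  have hBb : cfDen α n = b := hb
  have hb0 : 0 ≤ b := by
    have : (0 : ℝ) ≤ b := by linarith
    exact_mod_cast this
  obtain ⟨q, rfl⟩ := Int.eq_ofNat_of_zero_le hb0
  obtain ⟨gp, hgp⟩ := Option.ne_none_iff_exists'.1 (not_terminatedAt_of_irrational hα n)
  have h1 : gp.a = 1 := GenContFract.of_partNum_eq_one (GenContFract.partNum_eq_s_a hgp)
  obtain ⟨ifp', hs', hb'⟩ :=
    GenContFract.IntFractPair.exists_succ_get?_stream_of_gcf_of_get?_eq_some hgp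
  obtain ⟨ifp, hs, hfr, hof⟩ := GenContFract.IntFractPair.succ_nth_stream_eq_some_iff.1 hs'
  have hkey := GenContFract.sub_convs_eq hs
  simp only [hfr, if_false, hn.neg_one_pow] at hkey
  have hnext : cfDen α (n + 1) = gp.b * q + ((GenContFract.of α).contsAux n).b := by
    change ((GenContFract.of α).contsAux (n + 2)).b = _
    rw [GenContFract.contsAux_recurrence hgp rfl rfl]
    simp [h1, hb]
  have hfl : gp.b ≤ ifp.fr⁻¹ ∧ ifp.fr⁻¹ ≤ gp.b + 1 := by
    rw [← hb', ← hof]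
    simp only [GenContFract.IntFractPair.of]
    exact ⟨Int.floor_le _, (Int.lt_floor_add_one _).le⟩
  have hmono : cfDen α n ≤ cfDen α (n + 1) := cfDen_mono α n.le_succ
  refine ⟨a, q, by simpa using hBb, ?_⟩
  have hq : (1 : ℝ) ≤ q := by simpa [hBb] using hB1
  have hqn : (q : ℝ) ≤ cfDen α (n + 1) := by simpa [hBb] using hmono
  have hconv : (GenContFract.of α).convs n = a / q := by
    change ((GenContFract.of α).contsAux (n + 1)).a / ((GenContFract.of α).contsAux (n + 1)).b = _
    rw [ha, hb]; simp
  rw [hconv, hb] at hkey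
  set D := ifp.fr⁻¹ * ((q : ℤ) : ℝ) + ((GenContFract.of α).contsAux n).b with hD
  have hD1 : cfDen α (n + 1) ≤ D := by
    rw [hnext, hD]; push_cast; nlinarith [hfl.1]
  have hD2 : D ≤ 2 * cfDen α (n + 1) := by
    have : D ≤ cfDen α (n + 1) + q := by rw [hnext, hD]; push_cast; nlinarith [hfl.2]
    linarith
  have hD0 : 0 < D := by linarith
  have hval : α * q - a = 1 / D := by
    have : α - a / q = 1 / (q * D) := by simpa using hkey
    field_simp at this ⊢
    linarith
  rw [hval]
  exact ⟨one_div_le_one_div_of_le hD0 hD2, one_div_le_one_div_of_le (by linarith) hD1⟩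

/-! ### The choice of the convergents and the resulting scales -/

/-- A rapidly growing sequence of even indices of convergents. The growth makes the children of an
interval in the Cantor construction numerous and the rounding in `multA` negligible. -/
structure FastIndices (α : ℝ) (k : ℕ → ℕ) : Prop where
  even : ∀ n, Even (k n)
  strictMono : StrictMono k
  large : ∀ n : ℕ, 1000 * Real.exp ((n : ℝ) ^ 2) ≤ cfDen α (k n)
  growth : ∀ n, 100 * cfDen α (k n) * cfDen α (k n + 1) ≤ cfDen α (k (n + 1))

lemma exists_even_index {α : ℝ} (hα : Irrational α) (K : ℕ) (C : ℝ) :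
    ∃ m, Even m ∧ K < m ∧ C ≤ cfDen α m := by
  obtain ⟨M, hM⟩ := eventually_atTop.1 ((tendsto_cfDen hα).eventually_ge_atTop C)
  exact ⟨2 * (M + K + 1), even_two_mul _, by omega, hM _ (by omega)⟩

lemma exists_fastIndices {α : ℝ} (hα : Irrational α) : ∃ k, FastIndices α k := by
  choose next h_even h_lt h_le using exists_even_index hα
  let C : ℕ → ℕ → ℝ := fun n K =>
    max (1000 * Real.exp (((n + 1 : ℕ) : ℝ) ^ 2)) (100 * cfDen α K * cfDen α (K + 1))
  let k : ℕ → ℕ := fun n => Nat.rec (next 0 (1000 * Real.exp (((0 : ℕ) : ℝ) ^ 2)))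
    (fun n K => next K (C n K)) n
  have hk : ∀ n, k (n + 1) = next (k n) (C n (k n)) := fun n => rfl
  refine ⟨k, ?_, strictMono_nat_of_lt_succ fun n => ?_, ?_, fun n => ?_⟩
  · rintro (_ | n)
    · exact h_even _ _
    · rw [hk]; exact h_even _ _
  · rw [hk]; exact h_lt _ _
  · rintro (_ | n)
    · exact h_le _ _
    · rw [hk]; exact (le_max_left _ _).trans (h_le _ _)
  · rw [hk]; exact (le_max_right _ _).trans (h_le _ _)

lemma FastIndices.admissible {α : ℝ} (hα : Irrational α) {k : ℕ → ℕ} (hk : FastIndices α k) :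
    AdmissibleIndices α k := by
  have h1 := one_le_cfDen hα
  have hm : ∀ n, cfDen α (k n) ≤ cfDen α (k n + 1) := fun n => cfDen_mono α (Nat.le_succ _)
  have hgrow : ∀ n, 5 * cfDen α (k n + 1) ≤ cfDen α (k (n + 1)) := fun n => by
    have := hk.growth n
    nlinarith [h1 (k n), h1 (k n + 1)]
  refine ⟨fun n _ => hk.strictMono n.lt_succ_self, ?_, fun n _ => ?_, fun n _ => ?_, ?_,
    Or.inl fun n _ => hk.even n⟩
  · have := hk.large 1
    have h2 := Real.add_one_le_exp (((1 : ℕ) : ℝ) ^ 2)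
    norm_num at this h2
    linarith [hm 1]
  · linarith [hgrow n, hm n]
  · linarith [hgrow n, hm (n + 1)]
  · refine tendsto_atTop_mono' atTop ?_ tendsto_natCast_atTop_atTop
    filter_upwards [eventually_ge_atTop 1] with n hn
    have hn' : (0 : ℝ) < n := by exact_mod_cast hn
    rw [le_div_iff₀ hn', ← sq, Real.le_log_iff_exp_le (by linarith [h1 (k n)])]
    have := hk.large n
    linarith [Real.exp_pos ((n : ℝ) ^ 2)]

/-- Bounds on the heights `h` and the angles `θ` of the building blocks: here
`f_n (x) = h n * φ (Q n • x)` for a fixed profile `φ` on the circle, and the rotation by `α` moves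
`Q n • x` by the small angle `θ n`. At `n = 0` the bounds force `h 0 = 0`, by division by zero. -/
structure BlockScales (h θ : ℕ → ℝ) : Prop where
  h_nonneg : ∀ n, 0 ≤ h n
  h_lower : ∀ n : ℕ, 1 ≤ n → (4 / 3 : ℝ) ^ n / (n : ℝ) ^ 2 ≤ h n
  h_upper : ∀ n : ℕ, h n ≤ 1.02 * ((4 / 3 : ℝ) ^ n / (n : ℝ) ^ 2)
  θ_lower : ∀ n : ℕ, 0.49 * (3 / 4 : ℝ) ^ n ≤ θ n
  θ_upper : ∀ n : ℕ, θ n ≤ (3 / 4 : ℝ) ^ n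
  step_lower : ∀ n : ℕ, 1 / (2 * (n : ℝ) ^ 2) ≤ h n * θ n
  step_upper : ∀ n : ℕ, h n * θ n ≤ 1 / (n : ℝ) ^ 2

lemma FastIndices.multA_bounds {α : ℝ} {k : ℕ → ℕ} (hk : FastIndices α k) (n : ℕ) :
    0.99 * ((3 / 4 : ℝ) ^ n * cfDen α (k n + 1)) ≤ multA α k n ∧
      (multA α k n : ℝ) ≤ (3 / 4 : ℝ) ^ n * cfDen α (k n + 1) ∧ 1 ≤ multA α k n := by
  set t := (3 / 4 : ℝ) ^ n * cfDen α (k n + 1) with ht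
  have h1 : (4 / 3 : ℝ) ^ n ≤ Real.exp ((n : ℝ) ^ 2) := by
    have hn : (n : ℝ) ≤ (n : ℝ) ^ 2 := by exact_mod_cast Nat.le_self_pow two_ne_zero n
    calc (4 / 3 : ℝ) ^ n ≤ (Real.exp 1) ^ n := by
          gcongr; linarith [Real.add_one_le_exp (1 : ℝ)]
      _ = Real.exp n := by rw [← Real.exp_nat_mul, mul_one]
      _ ≤ _ := Real.exp_le_exp.2 hn
  have h2 : (3 / 4 : ℝ) ^ n * (4 / 3 : ℝ) ^ n = 1 := by rw [← mul_pow]; norm_num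
  have h3 : 1000 * (4 / 3 : ℝ) ^ n ≤ cfDen α (k n + 1) := by
    linarith [hk.large n, cfDen_mono α (Nat.le_succ (k n))]
  have h4 : (1000 : ℝ) ≤ t := by
    have : (3 / 4 : ℝ) ^ n * (1000 * (4 / 3 : ℝ) ^ n) ≤ t := by rw [ht]; gcongr
    linarith
  have h5 := Nat.floor_le (a := t) (by linarith)
  have h6 := Nat.lt_floor_add_one t
  refine ⟨?_, h5, ?_⟩
  · change _ ≤ ((⌊t⌋₊ : ℕ) : ℝ)
    linarith
  · exact Nat.one_le_floor_iff _ |>.2 (by linarith)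

lemma FastIndices.exists_scales {α : ℝ} (hα : Irrational α) {k : ℕ → ℕ} (hk : FastIndices α k) :
    ∃ (Q : ℕ → ℕ) (θ : ℕ → ℝ), (∀ n, freqQ α k n = Q n) ∧
      (∀ n, Q n • (α : UnitAddCircle) = (θ n : UnitAddCircle)) ∧
      BlockScales (fun n => lipL α k n / freqQ α k n) θ := by
  choose p q hq hlo hhi using fun n => exists_convergent_of_even hα (hk.even n)
  have h1 := one_le_cfDen hα
  have hA := hk.multA_bounds
  have hApos : ∀ n, (0 : ℝ) < multA α k n := fun n => by exact_mod_cast (hA n).2.2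
  -- `h n` only depends on the next denominator, as `q_{k_n}` cancels
  have hh : ∀ n, lipL α k n / freqQ α k n =
      cfDen α (k n + 1) / ((n : ℝ) ^ 2 * multA α k n) := fun n => by
    have := hApos n
    have := h1 (k n)
    rcases eq_or_ne n 0 with rfl | hn
    · simp [lipL]
    · have : (n : ℝ) ≠ 0 := by exact_mod_cast hn
      simp only [lipL, freqQ]
      field_simp
  have h34 : ∀ n : ℕ, (3 / 4 : ℝ) ^ n * (4 / 3 : ℝ) ^ n = 1 := fun n => by
    rw [← mul_pow]; norm_num
  -- the angle is `θ n = A_n (q_{k_n} α - p_{k_n})`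
  have hθ : ∀ n, cfDen α (k n + 1) / ((n : ℝ) ^ 2 * multA α k n) *
      (multA α k n * (α * q n - p n)) = cfDen α (k n + 1) * (α * q n - p n) / (n : ℝ) ^ 2 := by
    intro n
    have := hApos n
    rcases eq_or_ne n 0 with rfl | hn
    · simp
    · have : (n : ℝ) ≠ 0 := by exact_mod_cast hn
      field_simp
  refine ⟨fun n => q n * multA α k n, fun n => multA α k n * (α * q n - p n), fun n => ?_,
    fun n => ?_, ?_⟩
  · simp [freqQ, hq]
  · have : (multA α k n : ℝ) * (α * q n - p n) =
        ((q n * multA α k n : ℕ) : ℝ) * α - ((multA α k n * p n : ℤ) : ℝ) := by push_cast; ring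
    beta_reduce
    rw [this, AddCircle.coe_sub, ← nsmul_eq_mul, AddCircle.coe_nsmul]
    have h0 : (((multA α k n * p n : ℤ) : ℝ) : UnitAddCircle) = 0 := by
      rw [AddCircle.coe_eq_zero_iff]
      exact ⟨multA α k n * p n, by simp⟩
    rw [h0, sub_zero]
  · constructor
    · intro n
      rw [hh]
      have := h1 (k n + 1)
      positivity
    · intro n hn
      rw [hh]
      have hn' : (0 : ℝ) < n := by exact_mod_cast hn
      have h2 := hApos n
      rw [div_le_div_iff₀ (by positivity) (by positivity)]
      have : (4 / 3 : ℝ) ^ n * multA α k n ≤ cfDen α (k n + 1) := by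
        calc _ ≤ (4 / 3 : ℝ) ^ n * ((3 / 4 : ℝ) ^ n * cfDen α (k n + 1)) := by
              gcongr; exact (hA n).2.1
          _ = ((3 / 4 : ℝ) ^ n * (4 / 3 : ℝ) ^ n) * cfDen α (k n + 1) := by ring
          _ = _ := by rw [h34, one_mul]
      nlinarith [mul_le_mul_of_nonneg_left this (sq_nonneg (n : ℝ))]
    · intro n
      rw [hh]
      rcases Nat.eq_zero_or_pos n with rfl | hn
      · simp
      have hn' : (0 : ℝ) < n := by exact_mod_cast hn
      have h2 := hApos n
      rw [← mul_div_assoc, div_le_div_iff₀ (by positivity) (by positivity)]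
      have : cfDen α (k n + 1) ≤ 1.02 * ((4 / 3 : ℝ) ^ n * multA α k n) := by
        have : (4 / 3 : ℝ) ^ n * (0.99 * ((3 / 4 : ℝ) ^ n * cfDen α (k n + 1))) ≤
            (4 / 3 : ℝ) ^ n * multA α k n := by
          gcongr; exact (hA n).1
        have h5 : (4 / 3 : ℝ) ^ n * (0.99 * ((3 / 4 : ℝ) ^ n * cfDen α (k n + 1))) =
            0.99 * ((3 / 4 : ℝ) ^ n * (4 / 3 : ℝ) ^ n) * cfDen α (k n + 1) := by ring
        rw [h5, h34] at this
        linarith [h1 (k n + 1)]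
      nlinarith [mul_le_mul_of_nonneg_left this (sq_nonneg (n : ℝ))]
    · intro n
      have h2 := h1 (k n + 1)
      calc 0.49 * (3 / 4 : ℝ) ^ n ≤ 0.99 * ((3 / 4 : ℝ) ^ n * cfDen α (k n + 1)) *
            (1 / (2 * cfDen α (k n + 1))) := by
            field_simp; norm_num
        _ ≤ _ := by
            gcongr
            · exact (hA n).1
            · exact hlo n
    · intro n
      have h2 := h1 (k n + 1)
      have h3 : 0 ≤ α * q n - p n := le_trans (by positivity) (hlo n)
      calc _ ≤ ((3 / 4 : ℝ) ^ n * cfDen α (k n + 1)) * (1 / cfDen α (k n + 1)) := by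
            gcongr
            · exact (hA n).2.1
            · exact hhi n
        _ = _ := by field_simp
    · intro n
      have h2 := h1 (k n + 1)
      rw [hh, hθ]
      have : 1 / 2 ≤ cfDen α (k n + 1) * (α * q n - p n) := by
        calc (1 / 2 : ℝ) = cfDen α (k n + 1) * (1 / (2 * cfDen α (k n + 1))) := by field_simp
          _ ≤ _ := by gcongr; exact hlo n
      calc 1 / (2 * (n : ℝ) ^ 2) = (1 / 2) / (n : ℝ) ^ 2 := by ring
        _ ≤ _ := by gcongr
    · intro n
      have h2 := h1 (k n + 1)
      rw [hh, hθ]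
      have : cfDen α (k n + 1) * (α * q n - p n) ≤ 1 := by
        calc _ ≤ cfDen α (k n + 1) * (1 / cfDen α (k n + 1)) := by gcongr; exact hhi n
          _ = 1 := by field_simp
      gcongr

lemma FastIndices.exp_sq_le_freqQ {α : ℝ} (hα : Irrational α) {k : ℕ → ℕ} (hk : FastIndices α k)
    (n : ℕ) : 1000 * Real.exp ((n : ℝ) ^ 2) ≤ freqQ α k n := by
  have h1 : (1 : ℝ) ≤ multA α k n := by exact_mod_cast (hk.multA_bounds n).2.2
  exact (hk.large n).trans (le_mul_of_one_le_right (by linarith [one_le_cfDen hα (k n)]) h1)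

lemma FastIndices.freqQ_growth {α : ℝ} (hα : Irrational α) {k : ℕ → ℕ} (hk : FastIndices α k)
    (n : ℕ) : 100 * freqQ α k n ≤ freqQ α k (n + 1) := by
  have h1 : (1 : ℝ) ≤ multA α k (n + 1) := by exact_mod_cast (hk.multA_bounds (n + 1)).2.2
  have h2 := one_le_cfDen hα
  have h3 : (multA α k n : ℝ) ≤ cfDen α (k n + 1) :=
    (hk.multA_bounds n).2.1.trans (mul_le_of_le_one_left (by linarith [h2 (k n + 1)])
      (pow_le_one₀ (by norm_num) (by norm_num)))
  calc 100 * freqQ α k n ≤ 100 * (cfDen α (k n) * cfDen α (k n + 1)) := by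
        unfold freqQ; have := h2 (k n); gcongr
    _ ≤ cfDen α (k (n + 1)) := by linarith [hk.growth n]
    _ ≤ freqQ α k (n + 1) := le_mul_of_one_le_right (by linarith [h2 (k (n + 1))]) h1

/-! ### The profile of the building blocks -/

/-- The common shape of the building blocks, as a function on the circle: `0` within `1 / 12` of
`0`, `1 / 3` within `1 / 12` of `1 / 2`, and of slope `±1` in between. -/
def profile (z : UnitAddCircle) : ℝ := min (max (‖z‖ - 1 / 12) 0) (1 / 3)

lemma profile_nonneg (z : UnitAddCircle) : 0 ≤ profile z :=
  le_min (le_max_right _ _) (by norm_num)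

lemma profile_neg (z : UnitAddCircle) : profile (-z) = profile z := by simp [profile]

@[fun_prop]
lemma continuous_profile : Continuous profile := by unfold profile; fun_prop

lemma abs_profile_sub_le (z w : UnitAddCircle) : |profile z - profile w| ≤ ‖z - w‖ := by
  unfold profile
  calc _ ≤ |max (‖z‖ - 1 / 12) 0 - max (‖w‖ - 1 / 12) 0| := by
        have := abs_min_sub_min_le_max (max (‖z‖ - 1 / 12) 0) (1 / 3) (max (‖w‖ - 1 / 12) 0) (1 / 3)
        simpa using this
    _ ≤ |‖z‖ - ‖w‖| := by
        have := abs_max_sub_max_le_abs (‖z‖ - 1 / 12) (‖w‖ - 1 / 12) 0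
        simpa using this
    _ ≤ _ := abs_norm_sub_norm_le z w

lemma profile_coe {r : ℝ} (hr : |r| ≤ 1 / 2) :
    profile (r : UnitAddCircle) = min (max (|r| - 1 / 12) 0) (1 / 3) := by
  have h : ‖(r : UnitAddCircle)‖ = |r| :=
    (AddCircle.norm_coe_eq_abs_iff 1 one_ne_zero).2 (by simpa using hr)
  rw [profile, h]

lemma coe_sub_one (r : ℝ) : ((r - 1 : ℝ) : UnitAddCircle) = r := by
  rw [AddCircle.coe_sub, AddCircle.coe_period, sub_zero]

lemma exists_coe_eq (z : UnitAddCircle) : ∃ r : ℝ, |r| ≤ 1 / 2 ∧ (r : UnitAddCircle) = z := by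
  induction z using QuotientAddGroup.induction_on with
  | H x =>
    refine ⟨x - round x, abs_sub_round x, ?_⟩
    rw [AddCircle.coe_sub, sub_eq_self, AddCircle.coe_eq_zero_iff]
    exact ⟨round x, by simp⟩

/-- The half-turn exchanges the minima and the maxima of the profile. -/
lemma profile_add_half (z : UnitAddCircle) :
    profile (z + ((1 / 2 : ℝ) : UnitAddCircle)) = 1 / 3 - profile z := by
  obtain ⟨r, hr, rfl⟩ := exists_coe_eq z
  rw [← AddCircle.coe_add, profile_coe hr]
  obtain ⟨h1, h2⟩ := abs_le.1 hr
  rcases le_total r 0 with h | h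
  · rw [profile_coe (by rw [abs_le]; constructor <;> linarith), abs_of_nonpos h,
      abs_of_nonneg (by linarith)]
    rcases le_total (-r - 1 / 12) 0 with h3 | h3 <;>
      rcases le_total (r + 1 / 2 - 1 / 12) 0 with h4 | h4 <;>
      simp only [h3, h4, max_eq_left, max_eq_right] <;>
      simp only [min_def] <;> split_ifs <;> linarith
  · rw [← coe_sub_one, profile_coe (by rw [abs_le]; constructor <;> linarith), abs_of_nonneg h,
      abs_of_nonpos (by linarith)]
    rcases le_total (r - 1 / 12) 0 with h3 | h3 <;>
      rcases le_total (-(r + 1 / 2 - 1) - 1 / 12) 0 with h4 | h4 <;>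
      simp only [h3, h4, max_eq_left, max_eq_right] <;>
      simp only [min_def] <;> split_ifs <;> linarith

lemma profile_eq_zero {r : ℝ} (hr : |r| ≤ 1 / 12) : profile (r : UnitAddCircle) = 0 := by
  rw [profile_coe (by linarith), max_eq_right (by linarith)]; norm_num

lemma profile_eq_sub {r : ℝ} (h1 : 1 / 12 ≤ r) (h2 : r ≤ 5 / 12) :
    profile (r : UnitAddCircle) = r - 1 / 12 := by
  rw [profile_coe (by rw [abs_le]; constructor <;> linarith), abs_of_nonneg (by linarith),
    max_eq_left (by linarith), min_eq_left (by linarith)]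

lemma le_profile {r : ℝ} (h1 : 4 / 25 ≤ |r|) (h2 : |r| ≤ 21 / 25) :
    1 / 15 ≤ profile (r : UnitAddCircle) := by
  wlog hr : 0 ≤ r generalizing r
  · have := this (r := -r) (by simpa using h1) (by simpa using h2) (by linarith)
    rwa [AddCircle.coe_neg, profile_neg] at this
  rw [abs_of_nonneg hr] at h1 h2
  have key : ∀ s : ℝ, |s| ≤ 1 / 2 → 4 / 25 ≤ |s| → 1 / 15 ≤ profile (s : UnitAddCircle) := by
    intro s hs hs'
    rw [profile_coe hs]
    exact le_min (le_max_of_le_left (by linarith)) (by norm_num)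
  rcases le_total r (1 / 2) with h | h
  · exact key r (by rwa [abs_of_nonneg hr]) (by rwa [abs_of_nonneg hr])
  · rw [← coe_sub_one]
    have : |r - 1| = 1 - r := by rw [abs_of_nonpos (by linarith)]; ring
    exact key _ (by linarith) (by linarith)

lemma trapezoid_eq_profile (L : ℝ) {Q : ℝ} (hQ : 0 < Q) (x : ℝ) :
    trapezoid L Q x = L / Q * profile ((Q * x : ℝ) : UnitAddCircle) := by
  rw [profile, UnitAddCircle.norm_eq]
  simp only [trapezoid]
  set r := |Q * x - round (Q * x)|
  have h1 : r / Q ≤ 1 / (12 * Q) ↔ r ≤ 1 / 12 := by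
    rw [div_le_div_iff₀ hQ (by positivity)]; constructor <;> intro h <;> nlinarith
  have h2 : r / Q ≤ 5 / (12 * Q) ↔ r ≤ 5 / 12 := by
    rw [div_le_div_iff₀ hQ (by positivity)]; constructor <;> intro h <;> nlinarith
  simp only [h1, h2]
  split_ifs with h h'
  · rw [max_eq_right (by linarith)]; norm_num
  · rw [max_eq_left (by linarith), min_eq_left (by linarith)]; field_simp
  · rw [max_eq_left (by linarith), min_eq_right (by linarith)]; field_simp

/-! ### Ergodic sums -/

section ErgodicSum

variable {a : UnitAddCircle}

lemma ergodicSum_zero (f : UnitAddCircle → ℝ) (x : UnitAddCircle) : ergodicSum a f 0 x = 0 := by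
  change ergodicSum a f (Int.ofNat 0) x = 0
  simp [ergodicSum]

lemma ergodicSum_add_one (f : UnitAddCircle → ℝ) (m : ℤ) (x : UnitAddCircle) :
    ergodicSum a f (m + 1) x = ergodicSum a f m x + f (x + m • a) := by
  rcases m with n | n
  · change ergodicSum a f (Int.ofNat (n + 1)) x = ergodicSum a f (Int.ofNat n) x + _
    simp [ergodicSum, Finset.sum_range_succ]
  · rcases n with _ | n
    · change ergodicSum a f 0 x = ergodicSum a f (Int.negSucc 0) x + _
      rw [ergodicSum_zero]
      simp [ergodicSum, sub_eq_add_neg]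
    · have h : Int.negSucc (n + 1) + 1 = Int.negSucc n := by omega
      rw [h]
      simp only [ergodicSum, Finset.sum_range_succ _ (n + 1)]
      rw [negSucc_zsmul]
      rw [← sub_eq_add_neg]
      simp only [add_smul, one_smul]
      ring_nf

lemma cylinderMap_zpow_apply (f : C(UnitAddCircle, ℝ)) (m : ℤ) (p : UnitAddCircle × ℝ) :
    ((cylinderMap a f) ^ m) p = (p.1 + m • a, p.2 + ergodicSum a f m p.1) := by
  have hstep : ∀ m : ℤ, ((cylinderMap a f) ^ (m + 1)) p =
      cylinderMap a f (((cylinderMap a f) ^ m) p) := fun m => by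
    rw [add_comm, zpow_one_add]; rfl
  have hT : ∀ q, cylinderMap a f q = (q.1 + a, q.2 + f q.1) := fun q => rfl
  induction m using Int.induction_on with
  | zero => ext <;> simp [ergodicSum_zero]
  | succ n ih =>
    rw [hstep, ih, hT, ergodicSum_add_one]
    ext <;> simp [add_smul, add_assoc]
  | pred n ih =>
    have h := hstep (-n - 1)
    rw [sub_add_cancel, ih] at h
    have h2 := ergodicSum_add_one (a := a) f (-n - 1) p.1
    rw [sub_add_cancel] at h2
    apply (cylinderMap a f).injective
    rw [← h, hT, h2]
    ext <;> simp [sub_smul, add_assoc]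

/-- The additive cocycle identity. -/
lemma ergodicSum_add (f : C(UnitAddCircle, ℝ)) (m n : ℤ) (x : UnitAddCircle) :
    ergodicSum a f (m + n) x = ergodicSum a f n x + ergodicSum a f m (x + n • a) := by
  have h : ((cylinderMap a f) ^ (m + n)) (x, 0) =
      ((cylinderMap a f) ^ m) (((cylinderMap a f) ^ n) (x, 0)) := by rw [zpow_add]; rfl
  simp only [cylinderMap_zpow_apply] at h
  simpa using congrArg Prod.snd h

lemma continuous_ergodicSum (f : C(UnitAddCircle, ℝ)) (m : ℤ) :
    Continuous (ergodicSum a f m) := by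
  have h : ergodicSum a f m = fun x => (((cylinderMap a f) ^ m) (x, 0)).2 := by
    ext x; simp [cylinderMap_zpow_apply]
  rw [h]
  exact continuous_snd.comp (((cylinderMap a f) ^ m).continuous.comp (by fun_prop))

/-- The ergodic sums of a sum of coboundaries telescope. -/
lemma hasSum_ergodicSum {D : ℕ → C(UnitAddCircle, ℝ)} {f : C(UnitAddCircle, ℝ)}
    {B : ℕ → UnitAddCircle → ℝ} (hD : ∀ n x, D n x = B n (x + a) - B n x) (hf : HasSum D f)
    (m : ℤ) (x : UnitAddCircle) :
    HasSum (fun n => B n (x + m • a) - B n x) (ergodicSum a f m x) := by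
  have hpt : ∀ y, HasSum (fun n => B n (y + a) - B n y) (f y) := fun y => by
    have := (ContinuousMap.hasSum_apply hf y)
    simpa only [hD] using this
  have hy : ∀ m : ℤ, x + (m + 1) • a = x + m • a + a := fun m => by
    rw [add_smul, one_smul, add_assoc]
  induction m using Int.induction_on with
  | zero => simp [ergodicSum_zero]
  | succ n ih =>
    rw [ergodicSum_add_one]
    convert ih.add (hpt (x + (n : ℤ) • a)) using 2 with i
    rw [hy]; ring
  | pred n ih =>
    have h2 := ergodicSum_add_one (a := a) f (-n - 1) x
    rw [sub_add_cancel] at h2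
    have h3 := hy (-n - 1)
    rw [sub_add_cancel] at h3
    rw [eq_sub_of_add_eq h2.symm]
    refine (ih.sub (hpt (x + (-n - 1 : ℤ) • a))).congr_fun fun i => ?_
    rw [h3]; ring

lemma integral_coboundary (B : C(UnitAddCircle, ℝ)) :
    ∫ x : UnitAddCircle, (B (x + a) - B x) = 0 := by
  have hi : ∀ g : C(UnitAddCircle, ℝ), Integrable (g : UnitAddCircle → ℝ) volume := fun g =>
    g.continuous.integrable_of_hasCompactSupport (HasCompactSupport.of_compactSpace _)
  have h := hi ⟨fun x => B (x + a), by fun_prop⟩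
  rw [ContinuousMap.coe_mk] at h
  rw [integral_sub h (hi B), integral_add_right_eq_self (fun x => B x) a, sub_self]

lemma integral_eq_zero_of_hasSum {D : ℕ → C(UnitAddCircle, ℝ)} {f : C(UnitAddCircle, ℝ)}
    (hf : HasSum D f) (hD : ∀ n, ∫ x : UnitAddCircle, D n x = 0) :
    ∫ x : UnitAddCircle, f x = 0 := by
  have hi : ∀ g : C(UnitAddCircle, ℝ), Integrable (g : UnitAddCircle → ℝ) volume := fun g =>
    g.continuous.integrable_of_hasCompactSupport (HasCompactSupport.of_compactSpace _)
  have hcont : Continuous fun g : C(UnitAddCircle, ℝ) => ∫ x : UnitAddCircle, g x := by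
    refine (LipschitzWith.of_dist_le_mul (K := 1) fun g g' => ?_).continuous
    rw [dist_eq_norm, dist_eq_norm, ← integral_sub (hi g) (hi g'), NNReal.coe_one, one_mul]
    refine (norm_integral_le_of_norm_le_const (C := ‖g - g'‖)
      (Eventually.of_forall fun x => (g - g').norm_coe_le_norm x)).trans ?_
    rw [measureReal_def, UnitAddCircle.measure_univ, ENNReal.toReal_one, mul_one]
  refine tendsto_nhds_unique ((hcont.tendsto f).comp hf) ?_
  refine (tendsto_congr fun s => ?_).2 tendsto_const_nhds
  have : ∫ x : UnitAddCircle, (∑ n ∈ s, D n) x = ∑ n ∈ s, ∫ x : UnitAddCircle, D n x := by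
    simp only [ContinuousMap.coe_sum, Finset.sum_apply]
    exact integral_finsetSum _ fun n _ => hi (D n)
  rw [Function.comp_apply, this, Finset.sum_eq_zero fun n _ => hD n]

end ErgodicSum

/-! ### Divergence of the ergodic sums -/

lemma tendsto_pow_div_sq : Tendsto (fun n : ℕ => (4 / 3 : ℝ) ^ n / (n : ℝ) ^ 2) atTop atTop := by
  have h := tendsto_pow_const_div_const_pow_of_one_lt 2 (r := (4 / 3 : ℝ)) (by norm_num)
  have h2 : Tendsto (fun n : ℕ => (n : ℝ) ^ 2 / (4 / 3 : ℝ) ^ n) atTop (𝓝[>] 0) := by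
    refine tendsto_nhdsWithin_iff.2 ⟨h, ?_⟩
    filter_upwards [eventually_gt_atTop 0] with n hn
    have : (0 : ℝ) < n := by exact_mod_cast hn
    exact mem_Ioi.2 (by positivity)
  exact (tendsto_inv_nhdsGT_zero.comp h2).congr fun n => by simp

/-- The sum of the block heights is dominated by its last terms. -/
lemma sum_pow_div_sq_le {N : ℕ} (hN : 8 ≤ N) :
    ∑ n ∈ Finset.range N, (4 / 3 : ℝ) ^ n / (n : ℝ) ^ 2 ≤ 20 * ((4 / 3 : ℝ) ^ N / (N : ℝ) ^ 2) := by
  induction N, hN using Nat.le_induction with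
  | base => norm_num [Finset.sum_range_succ]
  | succ N hN ih =>
    rw [Finset.sum_range_succ]
    have hN' : (8 : ℝ) ≤ N := by exact_mod_cast hN
    refine (add_le_add_left ih _).trans ?_
    have h1 : 20 * ((4 / 3 : ℝ) ^ N / (N : ℝ) ^ 2) + (4 / 3 : ℝ) ^ N / (N : ℝ) ^ 2 =
        (4 / 3 : ℝ) ^ N * (21 / (N : ℝ) ^ 2) := by ring
    have h2 : 20 * ((4 / 3 : ℝ) ^ (N + 1) / ((N + 1 : ℕ) : ℝ) ^ 2) =
        (4 / 3 : ℝ) ^ N * ((80 / 3) / ((N : ℝ) + 1) ^ 2) := by push_cast; ring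
    rw [h1, h2]
    gcongr ?_ * ?_
    rw [div_le_div_iff₀ (by positivity) (by positivity)]
    nlinarith

namespace BlockScales

variable {h θ : ℕ → ℝ}

lemma h_zero (hs : BlockScales h θ) : h 0 = 0 :=
  le_antisymm (by simpa using hs.h_upper 0) (hs.h_nonneg 0)

lemma θ_nonneg (hs : BlockScales h θ) (n : ℕ) : 0 ≤ θ n :=
  le_trans (by positivity) (hs.θ_lower n)

/-- On the minima of all blocks every summand is nonnegative, and for each large time `m` there is
a block `N`, with `(4 / 3) ^ N` comparable to `m`, which the orbit has left its minimum of. -/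
lemma le_of_hasSum_at_min (hs : BlockScales h θ) {z : ℕ → UnitAddCircle}
    (hz : ∀ n, 1 ≤ n → ∃ u : ℝ, |u| ≤ 1 / 12 ∧ z n = u) (C : ℝ) :
    ∃ M : ℝ, ∀ m S : ℝ, M ≤ |m| →
      HasSum (fun n => h n * (profile (z n + ((m * θ n : ℝ) : UnitAddCircle)) - profile (z n))) S →
      C ≤ S := by
  obtain ⟨N₀, hN₀⟩ := eventually_atTop.1 (tendsto_pow_div_sq.eventually_ge_atTop (15 * C))
  refine ⟨(4 / 3 : ℝ) ^ (N₀ + 1), fun m S hm hS => ?_⟩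
  have hm1 : 1 ≤ 2 * |m| := by
    have := one_le_pow₀ (M₀ := ℝ) (a := 4 / 3) (by norm_num) (n := N₀ + 1)
    linarith
  obtain ⟨N, hN1, hN2⟩ := exists_nat_pow_near hm1 (y := (4 / 3 : ℝ)) (by norm_num)
  have hN : N₀ + 1 ≤ N := by
    have : (4 / 3 : ℝ) ^ (N₀ + 1) < (4 / 3 : ℝ) ^ (N + 1) := by linarith [abs_nonneg m]
    have := (pow_lt_pow_iff_right₀ (by norm_num : (1 : ℝ) < 4 / 3)).1 this
    omega
  have hnonneg : ∀ n,
      0 ≤ h n * (profile (z n + ((m * θ n : ℝ) : UnitAddCircle)) - profile (z n)) := by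
    intro n
    rcases Nat.eq_zero_or_pos n with rfl | hn
    · simp [hs.h_zero]
    · obtain ⟨u, hu, hzu⟩ := hz n hn
      refine mul_nonneg (hs.h_nonneg n) ?_
      rw [hzu, profile_eq_zero hu, sub_zero]
      exact profile_nonneg _
  refine le_trans ?_ (le_hasSum hS N fun n _ => hnonneg n)
  obtain ⟨u, hu, hzu⟩ := hz N (by omega)
  rw [hzu, profile_eq_zero hu, sub_zero, ← AddCircle.coe_add]
  have h34 : (3 / 4 : ℝ) ^ N * (4 / 3 : ℝ) ^ N = 1 := by rw [← mul_pow]; norm_num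
  have hpos : (0 : ℝ) < (3 / 4 : ℝ) ^ N := by positivity
  have hlow : 1 / 2 ≤ (3 / 4 : ℝ) ^ N * |m| := by nlinarith
  have hupp : (3 / 4 : ℝ) ^ N * |m| ≤ 2 / 3 := by rw [pow_succ] at hN2; nlinarith
  have hθ1 : 49 / 200 ≤ |m * θ N| := by
    rw [abs_mul, abs_of_nonneg (hs.θ_nonneg N)]
    nlinarith [hs.θ_lower N, abs_nonneg m]
  have hθ2 : |m * θ N| ≤ 2 / 3 := by
    rw [abs_mul, abs_of_nonneg (hs.θ_nonneg N)]
    nlinarith [hs.θ_upper N, abs_nonneg m]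
  have h3 : 1 / 15 ≤ profile ((u + m * θ N : ℝ) : UnitAddCircle) := by
    apply le_profile
    · have := abs_sub_abs_le_abs_sub (m * θ N) (-u)
      rw [abs_neg, sub_neg_eq_add, add_comm] at this
      linarith
    · have := abs_add_le u (m * θ N)
      linarith
  have h4 := hN₀ N (by omega)
  have h5 := hs.h_lower N (by omega)
  nlinarith [hs.h_nonneg N]

/-- On the slopes of all blocks, at time `m` the blocks `n` with `(4 / 3) ^ n` much larger than `m`
each contribute about `m / n ^ 2` with the sign of `m`. Together these dominate the contributions of
the remaining blocks, which are only bounded by their heights. -/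
lemma le_of_hasSum_at_slope (hs : BlockScales h θ) {z : ℕ → UnitAddCircle}
    (hz : ∀ n, 1 ≤ n → ∃ u : ℝ, 1 / 6 ≤ u ∧ u ≤ 1 / 3 ∧ z n = u) (C : ℝ) :
    ∃ M : ℝ, ∀ m σ S : ℝ, M ≤ m → |σ| = 1 →
      HasSum (fun n => h n * (profile (z n + ((σ * m * θ n : ℝ) : UnitAddCircle)) - profile (z n)))
        S → C ≤ σ * S := by
  obtain ⟨N₀, hN₀⟩ := eventually_atTop.1 (tendsto_pow_div_sq.eventually_ge_atTop C)
  obtain ⟨N₁, hN₁⟩ : ∃ N₁, N₀ + 1000 ≤ N₁ := ⟨_, le_rfl⟩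
  refine ⟨(4 / 3 : ℝ) ^ N₁, fun m σ S hm hσ hS => ?_⟩
  have hσ2 : σ * σ = 1 := by rw [← abs_mul_abs_self, hσ, one_mul]
  have hm1 : 1 ≤ m := (one_le_pow₀ (by norm_num)).trans hm
  have h34 : ∀ n : ℕ, (3 / 4 : ℝ) ^ n * (4 / 3 : ℝ) ^ n = 1 := fun n => by
    rw [← mul_pow]; norm_num
  have hex : ∃ N : ℕ, m * (3 / 4 : ℝ) ^ N ≤ 1 / 12 := by
    have : Tendsto (fun N : ℕ => m * (3 / 4 : ℝ) ^ N) atTop (𝓝 0) := by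
      simpa using (tendsto_pow_atTop_nhds_zero_of_lt_one (r := (3 / 4 : ℝ)) (by norm_num)
        (by norm_num)).const_mul m
    exact (this.eventually_le_const (by norm_num)).exists
  -- the blocks from `N` on are the slow ones
  obtain ⟨N, hN, hmin⟩ : ∃ N : ℕ, m * (3 / 4 : ℝ) ^ N ≤ 1 / 12 ∧
      ∀ n < N, ¬ m * (3 / 4 : ℝ) ^ n ≤ 1 / 12 := by
    classical exact ⟨Nat.find hex, Nat.find_spec hex, fun n => Nat.find_min hex⟩
  have hslow : ∀ n, N ≤ n → m * (3 / 4 : ℝ) ^ n ≤ 1 / 12 := fun n hn => by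
    refine le_trans ?_ hN
    gcongr ?_ * ?_
    exact pow_le_pow_of_le_one (by norm_num) (by norm_num) hn
  have hNbig : N₁ ≤ N := by
    by_contra! hlt
    have h1 := hslow _ hlt.le
    nlinarith [h34 N₁, pow_pos (by norm_num : (0 : ℝ) < 3 / 4) N₁]
  have hmN : (4 / 3 : ℝ) ^ N ≤ 16 * m := by
    obtain ⟨K, rfl⟩ : ∃ K, N = K + 1 := ⟨N - 1, by omega⟩
    have h1 := hmin K (by omega)
    have h2 := h34 K
    rw [pow_succ]
    nlinarith [pow_pos (by norm_num : (0 : ℝ) < 4 / 3) K]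
  set T : ℕ → ℝ := fun n =>
    σ * (h n * (profile (z n + ((σ * m * θ n : ℝ) : UnitAddCircle)) - profile (z n))) with hT
  have hTsum : HasSum T (σ * S) := hS.mul_left σ
  have hTlow : ∀ n, -(1 / 4) * h n ≤ T n := by
    intro n
    rcases Nat.eq_zero_or_pos n with rfl | hn
    · simp [hT, hs.h_zero]
    · obtain ⟨u, hu1, hu2, hzu⟩ := hz n hn
      have h1 : |profile (z n + ((σ * m * θ n : ℝ) : UnitAddCircle)) - profile (z n)| ≤ 1 / 4 := by
        have h2 := profile_nonneg (z n + ((σ * m * θ n : ℝ) : UnitAddCircle))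
        have h3 : profile (z n + ((σ * m * θ n : ℝ) : UnitAddCircle)) ≤ 1 / 3 := min_le_right _ _
        rw [abs_le, hzu, profile_eq_sub (r := u) (by linarith) (by linarith), ← hzu]
        constructor <;> linarith
      have h4 : |T n| ≤ h n * (1 / 4) := by
        rw [hT, abs_mul, hσ, one_mul, abs_mul, abs_of_nonneg (hs.h_nonneg n)]
        exact mul_le_mul_of_nonneg_left h1 (hs.h_nonneg n)
      linarith [neg_abs_le (T n)]
  have hTslow : ∀ n, N ≤ n → m * (1 / (2 * (n : ℝ) ^ 2)) ≤ T n := by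
    intro n hn
    obtain ⟨u, hu1, hu2, hzu⟩ := hz n (by omega)
    have h1 : |σ * m * θ n| ≤ 1 / 12 := by
      rw [abs_mul, abs_mul, hσ, one_mul, abs_of_nonneg (hs.θ_nonneg n), abs_of_nonneg (by linarith)]
      exact (mul_le_mul_of_nonneg_left (hs.θ_upper n) (by linarith)).trans (hslow n hn)
    obtain ⟨h2, h3⟩ := abs_le.1 h1
    have h4 : T n = m * (h n * θ n) := by
      simp only [hT]
      rw [hzu, ← AddCircle.coe_add, profile_eq_sub (by linarith) (by linarith),
        profile_eq_sub (by linarith) (by linarith)]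
      linear_combination h n * m * θ n * hσ2
    rw [h4]
    exact mul_le_mul_of_nonneg_left (hs.step_lower n) (by linarith)
  have hpart : ∑ n ∈ Finset.range (N + N), T n ≤ σ * S := by
    refine sum_le_hasSum _ (fun n hn => ?_) hTsum
    rw [Finset.mem_range, not_lt] at hn
    exact le_trans (by positivity) (hTslow n (by omega))
  have hN' : (1000 : ℝ) ≤ N := by exact_mod_cast (by omega : 1000 ≤ N)
  have hfast : -(51 / 10) * ((4 / 3 : ℝ) ^ N / (N : ℝ) ^ 2) ≤ ∑ n ∈ Finset.range N, T n := by
    have h1 : ∑ n ∈ Finset.range N, -(1 / 4) * (1.02 * ((4 / 3 : ℝ) ^ n / (n : ℝ) ^ 2)) ≤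
        ∑ n ∈ Finset.range N, T n :=
      Finset.sum_le_sum fun n _ => by linarith [hTlow n, hs.h_upper n]
    rw [← Finset.mul_sum, ← Finset.mul_sum] at h1
    linarith [sum_pow_div_sq_le (by omega : 8 ≤ N)]
  -- of the slow blocks it is enough to use the `N` ones with index in `[N, 2 N)`
  have hgain : (4 / 3 : ℝ) ^ N / (128 * N) ≤ ∑ i ∈ Finset.range N, T (N + i) := by
    calc (4 / 3 : ℝ) ^ N / (128 * N) ≤ 16 * m / (128 * N) := by gcongr
      _ = ∑ i ∈ Finset.range N, m * (1 / (2 * (2 * (N : ℝ)) ^ 2)) := by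
        rw [Finset.sum_const, Finset.card_range, nsmul_eq_mul]; field_simp; norm_num
      _ ≤ _ := Finset.sum_le_sum fun i hi => by
        refine le_trans ?_ (hTslow _ (Nat.le_add_right N i))
        have hi' : ((N + i : ℕ) : ℝ) ≤ 2 * N := by
          have := Finset.mem_range.1 hi
          exact_mod_cast (by omega : N + i ≤ 2 * N)
        have hi2 : (0 : ℝ) < ((N + i : ℕ) : ℝ) := by exact_mod_cast (by omega : 0 < N + i)
        gcongr
  rw [Finset.sum_range_add] at hpart
  have h1 : (4 / 3 : ℝ) ^ N / (128 * N) = (N / 128) * ((4 / 3 : ℝ) ^ N / (N : ℝ) ^ 2) := by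
    field_simp
  have h2 := hN₀ N (by omega)
  have h3 : 0 ≤ (4 / 3 : ℝ) ^ N / (N : ℝ) ^ 2 := by positivity
  nlinarith

end BlockScales

/-! ### Discrete orbits -/

section Discrete

variable {a : UnitAddCircle} {f : C(UnitAddCircle, ℝ)}

lemma hasDiscreteOrbit_of_tendsto {x : UnitAddCircle}
    (h : Tendsto (fun m : ℤ => |ergodicSum a f m x|) cofinite atTop) (t : ℝ) :
    HasDiscreteOrbit (cylinderMap a f) (x, t) := by
  rw [HasDiscreteOrbit, isClosed_and_discrete_iff]
  rintro ⟨y, s⟩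
  have hfin : {m : ℤ | ¬ |s| + |t| + 1 < |ergodicSum a f m x|}.Finite :=
    h.eventually_gt_atTop (|s| + |t| + 1)
  set E := (fun m : ℤ => ((cylinderMap a f) ^ m) (x, t)) ''
    {m : ℤ | ¬ |s| + |t| + 1 < |ergodicSum a f m x|} with hE
  have hU : {p : UnitAddCircle × ℝ | |p.2| < |s| + 1} ∩ (E \ {(y, s)})ᶜ ∈ 𝓝 (y, s) := by
    refine inter_mem (IsOpen.mem_nhds (isOpen_lt (by fun_prop) (by fun_prop)) ?_)
      (((hfin.image _).subset sdiff_subset).isClosed.isOpen_compl.mem_nhds ?_)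
    · simp
    · simp
  rw [disjoint_principal_right]
  filter_upwards [mem_nhdsWithin_of_mem_nhds hU, self_mem_nhdsWithin] with p hp hne hpo
  obtain ⟨m, rfl⟩ := hpo
  refine hp.2 ⟨⟨m, fun hlt => ?_, rfl⟩, hne⟩
  have h1 := hp.1
  simp only [cylinderMap_zpow_apply, mem_ofPred_eq] at h1
  have h2 := abs_sub_abs_le_abs_sub (ergodicSum a f m x) (-t)
  rw [abs_neg, sub_neg_eq_add, add_comm _ t] at h2
  linarith

/-- Vertical translations commute with the cylindrical transformation, so discreteness of the orbit
of a point depends only on its first coordinate. -/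
lemma HasDiscreteOrbit.vertical_shift {x : UnitAddCircle} {t : ℝ}
    (h : HasDiscreteOrbit (cylinderMap a f) (x, t)) (s : ℝ) :
    HasDiscreteOrbit (cylinderMap a f) (x, s) := by
  let V : (UnitAddCircle × ℝ) ≃ₜ (UnitAddCircle × ℝ) :=
    (Homeomorph.refl _).prodCongr (Homeomorph.addRight (s - t))
  have hV : fullOrbit (cylinderMap a f) (x, s) = V '' fullOrbit (cylinderMap a f) (x, t) := by
    unfold fullOrbit
    rw [← range_comp]
    congr 1
    ext1 m
    simp only [Function.comp_apply, cylinderMap_zpow_apply]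
    ext
    · rfl
    · change s + _ = t + _ + (s - t)
      ring
  rw [HasDiscreteOrbit, hV]
  exact ⟨V.isClosedMap _ h.1, h.2.image V.isInducing⟩

variable (a f) in
lemma setOf_hasDiscreteOrbit :
    {p : UnitAddCircle × ℝ | HasDiscreteOrbit (cylinderMap a f) p} =
      discreteBase a f ×ˢ (univ : Set ℝ) := by
  ext ⟨x, t⟩
  simp only [mem_ofPred_eq, mem_prod, mem_univ, and_true, discreteBase]
  exact ⟨fun h s => h.vertical_shift s, fun h => h t⟩

end Discrete

/-! ### Transitivity -/

/-- By Baire's theorem, a homeomorphism for which every nonempty open set meets some iterate of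
every other one has a dense orbit. -/
lemma isTransitiveHomeo_of_forall_isOpen {X : Type*} [TopologicalSpace X] [BaireSpace X]
    [SecondCountableTopology X] [Nonempty X] {T : X ≃ₜ X}
    (h : ∀ U V : Set X, IsOpen U → IsOpen V → U.Nonempty → V.Nonempty →
      ∃ x ∈ U, ∃ m : ℤ, (T ^ m) x ∈ V) : IsTransitiveHomeo T := by
  have hb := TopologicalSpace.isBasis_countableBasis X
  have hdense : Dense (⋂ V ∈ TopologicalSpace.countableBasis X, ⋃ m : ℤ, (T ^ m) ⁻¹' V) := by
    refine dense_biInter_of_isOpen (fun V hV => isOpen_iUnion fun m =>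
      (hb.isOpen hV).preimage (T ^ m).continuous) (TopologicalSpace.countable_countableBasis X)
      fun V hV => ?_
    rw [dense_iff_inter_open]
    intro U hU hUne
    obtain ⟨x, hx, m, hm⟩ := h U V hU (hb.isOpen hV) hUne
      (TopologicalSpace.nonempty_of_mem_countableBasis hV)
    exact ⟨x, hx, mem_iUnion.2 ⟨m, hm⟩⟩
  obtain ⟨p, hp⟩ := hdense.nonempty
  refine ⟨p, hb.dense_iff.2 fun V hV _ => ?_⟩
  obtain ⟨m, hm⟩ := mem_iUnion.1 (mem_iInter₂.1 hp V hV)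
  exact ⟨_, hm, m, rfl⟩

/-- If the ergodic sums at large times take all values in large intervals and the rotation is
dense, then the cylindrical transformation is transitive. Indeed, at a time `m` with `m • a` close
to `0` the ergodic sum takes a prescribed value `e` somewhere on the circle, and by the cocycle
identity it takes values close to `e` at all points of a long orbit segment of the rotation. -/
lemma isTransitiveHomeo_cylinderMap {a : UnitAddCircle} {f : C(UnitAddCircle, ℝ)}
    (ha : DenseRange fun m : ℤ => m • a)
    (hrec : ∀ (η : ℝ) (M : ℤ), 0 < η → ∃ m : ℤ, M ≤ m ∧ ‖m • a‖ < η)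
    (hunb : ∀ C : ℝ, ∀ᶠ m : ℤ in atTop, ∃ x y, ergodicSum a f m x ≤ -C ∧ C ≤ ergodicSum a f m y) :
    IsTransitiveHomeo (cylinderMap a f) := by
  refine isTransitiveHomeo_of_forall_isOpen ?_
  rintro U V hU hV ⟨⟨x, s⟩, hxU⟩ ⟨⟨y, t⟩, hyV⟩
  obtain ⟨ε₁, hε₁, hball₁⟩ := Metric.isOpen_iff.1 hU _ hxU
  obtain ⟨ε₂, hε₂, hball₂⟩ := Metric.isOpen_iff.1 hV _ hyV
  obtain ⟨ε, hε, hle₁, hle₂⟩ : ∃ ε > 0, ε ≤ ε₁ ∧ ε ≤ ε₂ :=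
    ⟨min ε₁ ε₂, lt_min hε₁ hε₂, min_le_left _ _, min_le_right _ _⟩
  obtain ⟨m₀, hm₀⟩ := ha.exists_dist_lt (y - x) (half_pos hε)
  replace hm₀ : dist (x + m₀ • a) y < ε / 2 := by
    rw [dist_comm, dist_eq_norm] at hm₀
    rw [dist_eq_norm]
    convert hm₀ using 2; abel
  set c := ergodicSum a f m₀ x
  obtain ⟨r₁, hr₁, hc₁⟩ := Metric.continuous_iff.1 (continuous_ergodicSum (a := a) f m₀) x
    (ε / 4) (by positivity)
  obtain ⟨r, hr, hrε, hc⟩ : ∃ r > 0, r ≤ ε / 2 ∧ ∀ x', dist x' x < r →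
      dist (ergodicSum a f m₀ x') c < ε / 4 :=
    ⟨min r₁ (ε / 2), lt_min hr₁ (by positivity), min_le_right _ _,
      fun x' hx' => hc₁ x' (hx'.trans_le (min_le_left _ _))⟩
  -- finitely many steps of the rotation carry every point of the circle near `x`
  obtain ⟨J, hJ⟩ : ∃ J : Finset ℤ, ∀ z : UnitAddCircle, ∃ j ∈ J, dist (z + j • a) x < r / 2 := by
    obtain ⟨J, hJ⟩ := isCompact_univ.elim_finite_subcover
      (fun j : ℤ => {z : UnitAddCircle | dist (z + j • a) x < r / 2})
      (fun j => isOpen_lt (by fun_prop) (by fun_prop)) (fun z _ => by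
        obtain ⟨j, hj⟩ := ha.exists_dist_lt (x - z) (half_pos hr)
        refine mem_iUnion.2 ⟨j, ?_⟩
        rw [dist_comm, dist_eq_norm] at hj
        rw [mem_ofPred_eq, dist_eq_norm]
        convert hj using 2; abel)
    refine ⟨J, fun z => ?_⟩
    simpa using hJ (mem_univ z)
  have hev : ∀ᶠ w : UnitAddCircle in 𝓝 0, ∀ j ∈ J, ∀ z,
      dist (ergodicSum a f j (z + w)) (ergodicSum a f j z) < ε / 4 := by
    rw [Filter.eventually_all_finset]
    intro j _
    obtain ⟨δ, hδ, hunif⟩ := Metric.uniformContinuous_iff.1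
      (CompactSpace.uniformContinuous_of_continuous (continuous_ergodicSum (a := a) f j)) (ε / 4)
      (by positivity)
    filter_upwards [Metric.ball_mem_nhds 0 hδ] with w hw z
    exact hunif (by simpa [dist_eq_norm] using hw)
  obtain ⟨η₁, hη₁, hJη⟩ := Metric.eventually_nhds_iff.1 hev
  obtain ⟨M, hM⟩ := eventually_atTop.1 (hunb |t - s - c|)
  obtain ⟨m, hmM, hmη⟩ := hrec (min η₁ (r / 2)) M (by positivity)
  obtain ⟨x₀, hx₀⟩ : t - s - c ∈ range (ergodicSum a f m) := by
    obtain ⟨x₁, x₂, h₁, h₂⟩ := hM m hmM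
    exact mem_range_of_exists_le_of_exists_ge (continuous_ergodicSum (a := a) f m)
      ⟨x₁, h₁.trans (neg_abs_le _)⟩ ⟨x₂, (le_abs_self _).trans h₂⟩
  obtain ⟨j, hjJ, hj⟩ := hJ x₀
  set x' := x₀ + j • a with hx'
  have hval : dist (ergodicSum a f m x') (t - s - c) < ε / 4 := by
    have h1 := ergodicSum_add (a := a) f m j x₀
    rw [add_comm m j, ergodicSum_add, hx₀] at h1
    have h2 := hJη (y := m • a) (by simpa using hmη.trans_le (min_le_left _ _)) j hjJ x₀
    rw [Real.dist_eq] at h2 ⊢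
    convert h2 using 2
    linarith
  have hmr : dist (x' + m • a) x < r := by
    calc dist (x' + m • a) x ≤ dist (x' + m • a) x' + dist x' x := dist_triangle _ _ _
      _ < r / 2 + r / 2 := by
        refine add_lt_add ?_ hj
        simpa [dist_eq_norm] using hmη.trans_le (min_le_right _ _)
      _ = r := by ring
  refine ⟨(x', s), hball₁ ?_, m₀ + m, hball₂ ?_⟩
  · rw [Metric.mem_ball, Prod.dist_eq, dist_self]
    exact max_lt (by linarith) (by linarith)
  · rw [cylinderMap_zpow_apply, Metric.mem_ball, Prod.dist_eq]
    refine max_lt ?_ ?_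
    · have h1 : x' + (m₀ + m) • a - (x + m₀ • a) = x' + m • a - x := by rw [add_smul]; abel
      have h2 : dist (x' + (m₀ + m) • a) (x + m₀ • a) < r := by
        rw [dist_eq_norm, h1, ← dist_eq_norm]; exact hmr
      change dist (x' + (m₀ + m) • a) y < ε₂
      linarith [dist_triangle (x' + (m₀ + m) • a) (x + m₀ • a) y]
    · change dist (s + ergodicSum a f (m₀ + m) x') t < ε₂
      rw [ergodicSum_add]
      have h1 := hc _ hmr
      rw [Real.dist_eq, abs_lt] at hval h1
      rw [Real.dist_eq, abs_lt]
      constructor <;> linarith [hval.1, hval.2, h1.1, h1.2]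

/-! ### Hausdorff dimension -/

open scoped NNReal ENNReal in
/-- A map whose inverse is Hölder continuous with exponent `s` on its image divides the Hausdorff
dimension by at most `1 / s`. -/
lemma mul_dimH_le_dimH_image {X Y : Type*} [MetricSpace X] [MetricSpace Y] {T : Set Y} {φ : Y → X}
    {s K : ℝ≥0} (hs : 0 < s)
    (h : ∀ y ∈ T, ∀ y' ∈ T, dist y y' ≤ K * dist (φ y) (φ y') ^ (s : ℝ)) :
    s * dimH T ≤ dimH (φ '' T) := by
  rcases T.eq_empty_or_nonempty with rfl | ⟨y₀, hy₀⟩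
  · simp
  have : Nonempty Y := ⟨y₀⟩
  have hinj : InjOn φ T := fun y hy y' hy' heq => by
    have := h y hy y' hy'
    rw [heq, dist_self, Real.zero_rpow (by exact_mod_cast hs.ne'), mul_zero] at this
    exact dist_le_zero.1 this
  have hold : HolderOnWith K s (Function.invFunOn φ T) (φ '' T) := by
    rintro _ ⟨y, hy, rfl⟩ _ ⟨y', hy', rfl⟩
    rw [hinj.leftInvOn_invFunOn hy, hinj.leftInvOn_invFunOn hy', edist_dist, edist_dist,
      ENNReal.ofReal_rpow_of_nonneg dist_nonneg s.coe_nonneg, ← ENNReal.ofReal_coe_nnreal,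
      ← ENNReal.ofReal_mul K.coe_nonneg]
    exact ENNReal.ofReal_le_ofReal (h y hy y' hy')
  have h1 := hold.dimH_image_le hs
  have h2 : Function.invFunOn φ T '' (φ '' T) = T := hinj.invFunOn_image Subset.rfl
  rw [h2] at h1
  rwa [mul_comm, ← ENNReal.le_div_iff_mul_le (Or.inl (by exact_mod_cast hs.ne'))
    (Or.inl ENNReal.coe_ne_top)]

open scoped NNReal ENNReal in
lemma le_of_forall_mul_le {d D : ℝ≥0∞} (hd : d ≠ ∞)
    (h : ∀ s : ℝ≥0, 0 < s → s < 1 → s * d ≤ D) : d ≤ D := by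
  have h1 : Tendsto (fun s : ℝ≥0 => (s : ℝ≥0∞) * d) (𝓝[<] 1) (𝓝 ((1 : ℝ≥0) * d)) :=
    ENNReal.Tendsto.mul_const ((ENNReal.continuous_coe.tendsto 1).mono_left nhdsWithin_le_nhds)
      (Or.inr hd)
  rw [ENNReal.coe_one, one_mul] at h1
  have : (𝓝[<] (1 : ℝ≥0)).NeBot := nhdsLT_neBot_of_exists_lt ⟨0, one_pos⟩
  refine le_of_tendsto h1 ?_
  filter_upwards [Ioo_mem_nhdsLT (zero_lt_one (α := ℝ≥0))] with s hs
  exact h s hs.1 hs.2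

/-- A set parametrized by the unit interval with inverse Hölder continuous of every exponent less
than `1` has dimension at least `1`, and its product with a line has dimension at least `2`. -/
lemma le_dimH_of_holder_inverse {X : Type*} [MetricSpace X] {A : Set X} {g : ℝ → X}
    (hgA : ∀ y ∈ Ico (0 : ℝ) 1, g y ∈ A)
    (hg : ∀ s : ℝ, 0 < s → s < 1 → ∃ K : ℝ, ∀ y ∈ Ico (0 : ℝ) 1, ∀ y' ∈ Ico (0 : ℝ) 1,
      |y - y'| ≤ K * dist (g y) (g y') ^ s) :
    1 ≤ dimH A ∧ 2 ≤ dimH (A ×ˢ (univ : Set ℝ)) := by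
  constructor
  · refine le_of_forall_mul_le ENNReal.one_ne_top fun s hs0 hs1 => ?_
    obtain ⟨K, hK⟩ := hg s (by exact_mod_cast hs0) (by exact_mod_cast hs1)
    have h1 : dimH (Ico (0 : ℝ) 1) = 1 := by
      rw [Real.dimH_of_nonempty_interior (by simp)]; simp
    rw [← h1]
    refine (mul_dimH_le_dimH_image (K := K.toNNReal) (φ := g) hs0 fun y hy y' hy' => ?_).trans
      (dimH_mono (image_subset_iff.2 hgA))
    rw [Real.dist_eq]
    refine (hK y hy y' hy').trans ?_
    gcongr
    exact Real.le_coe_toNNReal K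
  · refine le_of_forall_mul_le ENNReal.ofNat_ne_top fun s hs0 hs1 => ?_
    obtain ⟨K, hK⟩ := hg s (by exact_mod_cast hs0) (by exact_mod_cast hs1)
    have h1 : dimH (Ico (0 : ℝ) 1 ×ˢ Ico (0 : ℝ) 1) = 2 := by
      rw [Real.dimH_of_nonempty_interior (by simp [interior_prod_eq])]; simp
    rw [← h1]
    refine (mul_dimH_le_dimH_image (K := max K.toNNReal 1) (φ := Prod.map g id) hs0
      fun p hp p' hp' => ?_).trans (dimH_mono ?_)
    · set D := dist (Prod.map g id p) (Prod.map g id p') with hD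
      have hD1 : dist (g p.1) (g p'.1) ≤ D := le_max_left _ _
      have hD2 : dist p.2 p'.2 ≤ D := le_max_right _ _
      rw [Prod.dist_eq]
      refine max_le ?_ ?_
      · rw [Real.dist_eq]
        refine (hK _ hp.1 _ hp'.1).trans ?_
        gcongr
        exact (Real.le_coe_toNNReal K).trans (by exact_mod_cast le_max_left _ _)
      · have h2 : dist p.2 p'.2 ≤ 1 := by
          rw [Real.dist_eq, abs_le]
          constructor <;> linarith [hp.2.1, hp.2.2, hp'.2.1, hp'.2.2]
        calc dist p.2 p'.2 ≤ dist p.2 p'.2 ^ (s : ℝ) :=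
              Real.self_le_rpow_of_le_one dist_nonneg h2 (by exact_mod_cast hs1.le)
          _ ≤ D ^ (s : ℝ) := by gcongr
          _ ≤ _ := le_mul_of_one_le_left (by positivity) (by exact_mod_cast le_max_right _ _)
    · rintro _ ⟨p, hp, rfl⟩
      exact ⟨hgA _ hp.1, mem_univ _⟩

lemma lipschitzWith_coe_unitAddCircle : LipschitzWith 1 ((↑) : ℝ → UnitAddCircle) :=
  LipschitzWith.of_dist_le_mul fun x y => by
    rw [dist_eq_norm, dist_eq_norm, ← AddCircle.coe_sub, NNReal.coe_one, one_mul]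
    exact QuotientAddGroup.norm_mk_le_norm

lemma dimH_unitAddCircle_le (A : Set UnitAddCircle) : dimH A ≤ 1 := by
  have h := lipschitzWith_coe_unitAddCircle.dimH_range_le
  rw [Real.dimH_univ] at h
  refine (dimH_mono fun x _ => ?_).trans h
  obtain ⟨r, -, hr⟩ := exists_coe_eq x
  exact ⟨r, hr⟩

lemma dimH_unitAddCircle_prod_le (A : Set (UnitAddCircle × ℝ)) : dimH A ≤ 2 := by
  have hL : LipschitzWith 1 (Prod.map ((↑) : ℝ → UnitAddCircle) (id : ℝ → ℝ)) :=
    LipschitzWith.of_dist_le_mul fun x y => by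
      rw [NNReal.coe_one, one_mul, Prod.dist_eq, Prod.dist_eq]
      refine max_le_max ?_ le_rfl
      simpa using lipschitzWith_coe_unitAddCircle.dist_le_mul x.1 y.1
  have h := hL.dimH_range_le
  rw [Real.dimH_univ_eq_finrank] at h
  refine (dimH_mono fun x _ => ?_).trans (h.trans (by simp))
  obtain ⟨r, -, hr⟩ := exists_coe_eq x.1
  exact ⟨(r, x.2), Prod.ext hr rfl⟩

/-! ### The Cantor sets -/

/-- The number of intervals of the next generation used inside each interval of generation `n`,
when the intervals of generation `n` have length `1 / (6 R n)` and one lies in each period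
`1 / R n`. -/
def childCount (R : ℕ → ℝ) (n : ℕ) : ℕ := ⌊R (n + 1) / R n / 6⌋₊ - 1

/-- The index of the first interval of generation `n + 1` inside the `j`-th interval of generation
`n`, whose centre is `(c + j) / R n`. -/
def firstChild (R : ℕ → ℝ) (c : ℝ) (n j : ℕ) : ℕ :=
  ⌈(c - 1 / 12 + j) * (R (n + 1) / R n) - (c - 1 / 12)⌉₊

/-- The intervals of the Cantor construction selected by the expansion of `y` in the mixed radix
`childCount R`. The first component at `n` is the index of the interval of generation `n`, the
second one the remainder of the expansion. -/
def cantorAddress (R : ℕ → ℝ) (c y : ℝ) : ℕ → ℕ × ℝ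
  | 0 => (1, y)
  | n + 1 =>
    (firstChild R c n (cantorAddress R c y n).1 + ⌊childCount R n * (cantorAddress R c y n).2⌋₊,
      Int.fract (childCount R n * (cantorAddress R c y n).2))

/-- The point of the Cantor set whose address is given by the expansion of `y`, as the supremum of
the left endpoints of the selected intervals. -/
def cantorPoint (R : ℕ → ℝ) (c y : ℝ) : ℝ :=
  ⨆ n, (c - 1 / 12 + (cantorAddress R c y n).1) / R n

section Cantor

variable {R : ℕ → ℝ} {c y : ℝ}

lemma childCount_bounds (hR0 : ∀ n, 0 < R n) (hR : ∀ n, 100 * R n ≤ R (n + 1)) (n : ℕ) :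
    R (n + 1) / R n / 12 ≤ childCount R n ∧ (childCount R n : ℝ) ≤ R (n + 1) / R n / 6 - 1 ∧
      8 ≤ childCount R n := by
  have hρ : 100 ≤ R (n + 1) / R n := by rw [le_div_iff₀ (hR0 n)]; exact hR n
  set ρ := R (n + 1) / R n
  have h1 := Nat.floor_le (a := ρ / 6) (by linarith)
  have h2 := Nat.lt_floor_add_one (ρ / 6)
  have h3 : 16 ≤ ⌊ρ / 6⌋₊ := Nat.le_floor (by push_cast; linarith)
  have h5 : childCount R n = ⌊ρ / 6⌋₊ - 1 := rfl
  have h4 : (childCount R n : ℝ) = ⌊ρ / 6⌋₊ - 1 := by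
    rw [h5, Nat.cast_sub (by omega), Nat.cast_one]
  refine ⟨by linarith, by linarith, ?_⟩
  omega

lemma cantorAddress_snd_mem (hy : y ∈ Ico (0 : ℝ) 1) (n : ℕ) :
    (cantorAddress R c y n).2 ∈ Ico (0 : ℝ) 1 := by
  rcases n with _ | n
  · exact hy
  · exact ⟨Int.fract_nonneg _, Int.fract_lt_one _⟩

lemma digit_lt {n : ℕ} (hn : 0 < childCount R n) {r : ℝ}
    (hr : r ∈ Ico (0 : ℝ) 1) : ⌊childCount R n * r⌋₊ < childCount R n := by
  have hn' : (0 : ℝ) < childCount R n := by exact_mod_cast hn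
  rw [Nat.floor_lt (mul_nonneg hn'.le hr.1)]
  exact mul_lt_of_lt_one_right hn' hr.2

lemma one_le_cantorAddress (hc : 0 ≤ c) (hR0 : ∀ n, 0 < R n) (hR : ∀ n, 100 * R n ≤ R (n + 1))
    (n : ℕ) : 1 ≤ (cantorAddress R c y n).1 := by
  induction n with
  | zero => exact le_rfl
  | succ n ih =>
    refine le_add_right (Nat.one_le_iff_ne_zero.2 (Nat.ceil_pos.2 ?_).ne')
    have hρ : 100 ≤ R (n + 1) / R n := by rw [le_div_iff₀ (hR0 n)]; exact hR n
    have ih' : (1 : ℝ) ≤ (cantorAddress R c y n).1 := by exact_mod_cast ih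
    nlinarith

lemma cantorAddress_nested (hc : 0 ≤ c) (hR0 : ∀ n, 0 < R n) (hR : ∀ n, 100 * R n ≤ R (n + 1))
    (hy : y ∈ Ico (0 : ℝ) 1) (n : ℕ) :
    (c - 1 / 12 + (cantorAddress R c y n).1) / R n ≤
        (c - 1 / 12 + (cantorAddress R c y (n + 1)).1) / R (n + 1) ∧
      (c + 1 / 12 + (cantorAddress R c y (n + 1)).1) / R (n + 1) ≤
        (c + 1 / 12 + (cantorAddress R c y n).1) / R n := by
  have hρ : 100 ≤ R (n + 1) / R n := by rw [le_div_iff₀ (hR0 n)]; exact hR n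
  have hRρ : R (n + 1) = R (n + 1) / R n * R n := by field_simp [(hR0 n).ne']
  obtain ⟨hN1, hN2, hN3⟩ := childCount_bounds hR0 hR n
  have hdig := digit_lt (by omega : 0 < childCount R n)
    (cantorAddress_snd_mem (R := R) (c := c) hy n)
  have hj : (1 : ℝ) ≤ (cantorAddress R c y n).1 := by
    exact_mod_cast one_le_cantorAddress hc hR0 hR n
  have hstep : (cantorAddress R c y (n + 1)).1 = firstChild R c n (cantorAddress R c y n).1 +
    ⌊childCount R n * (cantorAddress R c y n).2⌋₊ := rfl
  rw [hstep]
  set ρ := R (n + 1) / R n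
  set i := ⌊childCount R n * (cantorAddress R c y n).2⌋₊
  have hi : (i : ℝ) ≤ ρ / 6 - 2 := by
    have : (i : ℝ) + 1 ≤ childCount R n := by exact_mod_cast hdig
    linarith
  have h1 : (c - 1 / 12 + (cantorAddress R c y n).1) * ρ - (c - 1 / 12) ≤
      firstChild R c n (cantorAddress R c y n).1 := Nat.le_ceil _
  have h2 : (firstChild R c n (cantorAddress R c y n).1 : ℝ) <
      (c - 1 / 12 + (cantorAddress R c y n).1) * ρ - (c - 1 / 12) + 1 :=
    Nat.ceil_lt_add_one (by nlinarith)
  have hi0 : (0 : ℝ) ≤ i := i.cast_nonneg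
  have hn := hR0 n
  rw [hRρ, div_le_div_iff₀ hn (by positivity), div_le_div_iff₀ (by positivity) hn]
  push_cast
  constructor
  · rw [← mul_assoc]
    gcongr
    linarith
  · rw [← mul_assoc]
    gcongr
    linarith

lemma cantorPoint_mem (hc : 0 ≤ c) (hR0 : ∀ n, 0 < R n) (hR : ∀ n, 100 * R n ≤ R (n + 1))
    (hy : y ∈ Ico (0 : ℝ) 1) (n : ℕ) :
    c - 1 / 12 + (cantorAddress R c y n).1 ≤ cantorPoint R c y * R n ∧
      cantorPoint R c y * R n ≤ c + 1 / 12 + (cantorAddress R c y n).1 := by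
  have hmono : Monotone fun n => (c - 1 / 12 + (cantorAddress R c y n).1) / R n :=
    monotone_nat_of_le_succ fun n => (cantorAddress_nested hc hR0 hR hy n).1
  have hanti : Antitone fun n => (c + 1 / 12 + (cantorAddress R c y n).1) / R n :=
    antitone_nat_of_succ_le fun n => (cantorAddress_nested hc hR0 hR hy n).2
  have h := mem_iInter.1 (hmono.ciSup_mem_iInter_Icc_of_antitone hanti fun n => by
    have := hR0 n
    beta_reduce
    gcongr
    linarith) n
  exact ⟨(div_le_iff₀ (hR0 n)).1 h.1, (le_div_iff₀ (hR0 n)).1 h.2⟩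

/-- Numbers with the same first `n` digits differ by the difference of their remainders, scaled. -/
lemma sub_eq_div_of_agree (hR0 : ∀ n, 0 < R n) (hR : ∀ n, 100 * R n ≤ R (n + 1)) {y' : ℝ}
    (hy : y ∈ Ico (0 : ℝ) 1) (hy' : y' ∈ Ico (0 : ℝ) 1) (n : ℕ)
    (h : ∀ i ≤ n, (cantorAddress R c y i).1 = (cantorAddress R c y' i).1) :
    y - y' = ((cantorAddress R c y n).2 - (cantorAddress R c y' n).2) /
      ∏ i ∈ Finset.range n, (childCount R i : ℝ) := by
  induction n with
  | zero => simp [cantorAddress]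
  | succ n ih =>
    rw [ih fun i hi => h i (by omega)]
    have hN := (childCount_bounds hR0 hR n).2.2
    have hN' : (childCount R n : ℝ) ≠ 0 := by exact_mod_cast (by omega : childCount R n ≠ 0)
    have hprod : ∏ i ∈ Finset.range n, (childCount R i : ℝ) ≠ 0 :=
      Finset.prod_ne_zero_iff.2 fun i _ => by
        have := (childCount_bounds hR0 hR i).2.2
        exact_mod_cast (by omega : childCount R i ≠ 0)
    have hexp : ∀ w ∈ Ico (0 : ℝ) 1, childCount R n * (cantorAddress R c w n).2 =
        (⌊childCount R n * (cantorAddress R c w n).2⌋₊ : ℝ) + (cantorAddress R c w (n + 1)).2 := by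
      intro w hw
      have h0 : 0 ≤ childCount R n * (cantorAddress R c w n).2 :=
        mul_nonneg (Nat.cast_nonneg _) (cantorAddress_snd_mem hw n).1
      rw [natCast_floor_eq_intCast_floor h0]
      exact (Int.floor_add_fract _).symm
    have hdig : ⌊childCount R n * (cantorAddress R c y n).2⌋₊ =
        ⌊childCount R n * (cantorAddress R c y' n).2⌋₊ := by
      have h1 := h (n + 1) le_rfl
      simp only [cantorAddress] at h1
      rw [h n (by omega)] at h1
      omega
    have h1 := hexp y hy
    have h2 := hexp y' hy'
    rw [hdig] at h1
    rw [Finset.prod_range_succ]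
    field_simp
    linear_combination h1 - h2

/-- The number of intervals of generation `n` falls short of the number `R n` of periods by an
exponential factor only. -/
lemma le_prod_childCount (hR0 : ∀ n, 0 < R n) (hR : ∀ n, 100 * R n ≤ R (n + 1)) (n : ℕ) :
    R n ≤ R 0 * 12 ^ n * ∏ i ∈ Finset.range n, (childCount R i : ℝ) := by
  induction n with
  | zero => simp
  | succ n ih =>
    have h1 := (childCount_bounds hR0 hR n).1
    have h2 : R (n + 1) = 12 * (R (n + 1) / R n / 12) * R n := by field_simp [(hR0 n).ne']
    rw [Finset.prod_range_succ, h2]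
    calc 12 * (R (n + 1) / R n / 12) * R n ≤ 12 * childCount R n *
          (R 0 * 12 ^ n * ∏ i ∈ Finset.range n, (childCount R i : ℝ)) := by
          have := hR0 n
          gcongr
      _ = _ := by ring

/-- Superexponential growth of `R` absorbs the exponential loss of `le_prod_childCount` into an
arbitrarily small power of `R n`. -/
lemma pow_mul_rpow_le (hR : ∀ n : ℕ, Real.exp ((n : ℝ) ^ 2) ≤ R n) {s : ℝ} (hs : s < 1) (n : ℕ) :
    12 ^ n * R n ^ s ≤ Real.exp (9 / (4 * (1 - s))) * R n := by
  have hpos : 0 < R n := (Real.exp_pos _).trans_le (hR n)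
  have he : 0 < 1 - s := by linarith
  have h1 : R n = R n ^ s * R n ^ (1 - s) := by rw [← Real.rpow_add hpos]; simp
  have h2 : Real.exp ((n : ℝ) ^ 2 * (1 - s)) ≤ R n ^ (1 - s) := by
    rw [Real.exp_mul]
    exact Real.rpow_le_rpow (Real.exp_pos _).le (hR n) he.le
  have h3 : (12 : ℝ) ^ n ≤ Real.exp (3 * n) := by
    have h12 : (12 : ℝ) ≤ Real.exp 3 := by
      have h27 := Real.exp_one_gt_d9
      have : Real.exp 3 = Real.exp 1 ^ 3 := by rw [← Real.exp_nat_mul]; norm_num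
      rw [this]
      calc (12 : ℝ) ≤ 2.5 ^ 3 := by norm_num
        _ ≤ _ := by gcongr; linarith
    calc (12 : ℝ) ^ n ≤ Real.exp 3 ^ n := by gcongr
      _ = _ := by rw [← Real.exp_nat_mul, mul_comm]
  have h4 : (12 : ℝ) ^ n ≤ Real.exp (9 / (4 * (1 - s))) * R n ^ (1 - s) := by
    refine h3.trans ?_
    calc Real.exp (3 * n) ≤ Real.exp (9 / (4 * (1 - s)) + (n : ℝ) ^ 2 * (1 - s)) := by
          refine Real.exp_le_exp.2 ?_
          have : 9 / (4 * (1 - s)) + (n : ℝ) ^ 2 * (1 - s) - 3 * n =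
              (2 * (1 - s) * n - 3) ^ 2 / (4 * (1 - s)) := by field_simp; ring
          have : 0 ≤ (2 * (1 - s) * n - 3) ^ 2 / (4 * (1 - s)) := by positivity
          linarith
      _ ≤ _ := by rw [Real.exp_add]; gcongr
  calc 12 ^ n * R n ^ s ≤ Real.exp (9 / (4 * (1 - s))) * R n ^ (1 - s) * R n ^ s := by gcongr
    _ = Real.exp (9 / (4 * (1 - s))) * (R n ^ s * R n ^ (1 - s)) := by ring
    _ = _ := by rw [← h1]

/-- The inverse of the parametrization of the Cantor set by `y` is Hölder continuous with every
exponent `s < 1`. If the addresses of `y` and `y'` first differ in generation `n + 1`, by `d`, then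
`|y - y'|` is at most `2 d / (N P)`, with `N = childCount R n` and `P` the product of the earlier
counts, while the two points of the Cantor set are at least `d / 2` periods `1 / R (n + 1)`
apart. -/
lemma exists_cantorPoint_bound (hc : 0 ≤ c) (hR : ∀ n, 100 * R n ≤ R (n + 1))
    (hexp : ∀ n : ℕ, Real.exp ((n : ℝ) ^ 2) ≤ R n) {s : ℝ} (hs0 : 0 < s) (hs1 : s < 1) :
    ∃ K : ℝ, ∀ y ∈ Ico (0 : ℝ) 1, ∀ y' ∈ Ico (0 : ℝ) 1,
      |y - y'| ≤ K * |cantorPoint R c y - cantorPoint R c y'| ^ s := by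
  have hR0 : ∀ n, 0 < R n := fun n => (Real.exp_pos _).trans_le (hexp n)
  refine ⟨2 * 24 ^ s * R 0 * Real.exp (9 / (4 * (1 - s))), fun y hy y' hy' => ?_⟩
  have hNpos : ∀ i, (8 : ℝ) ≤ childCount R i := fun i => by
    exact_mod_cast (childCount_bounds hR0 hR i).2.2
  have hprodpos : ∀ n, 0 < ∏ i ∈ Finset.range n, (childCount R i : ℝ) := fun n =>
    Finset.prod_pos fun i _ => by linarith [hNpos i]
  have hK : 0 ≤ 2 * 24 ^ s * R 0 * Real.exp (9 / (4 * (1 - s))) := by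
    have := hR0 0
    positivity
  by_cases hagree : ∀ i, (cantorAddress R c y i).1 = (cantorAddress R c y' i).1
  · have hle : ∀ n : ℕ, |y - y'| ≤ (1 / 8 : ℝ) ^ n := fun n => by
      have h1 := cantorAddress_snd_mem (R := R) (c := c) hy n
      have h2 := cantorAddress_snd_mem (R := R) (c := c) hy' n
      have h3 : (8 : ℝ) ^ n ≤ ∏ i ∈ Finset.range n, (childCount R i : ℝ) := by
        have := Finset.prod_le_prod (s := Finset.range n) (f := fun _ => (8 : ℝ))
          (g := fun i => (childCount R i : ℝ)) (fun _ _ => by norm_num) fun i _ => hNpos i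
        simpa using this
      rw [sub_eq_div_of_agree hR0 hR hy hy' n fun i _ => hagree i, abs_div,
        abs_of_pos (hprodpos n), one_div_pow]
      have h4 : |(cantorAddress R c y n).2 - (cantorAddress R c y' n).2| ≤ 1 := by
        rw [abs_le]; constructor <;> linarith [h1.1, h1.2, h2.1, h2.2]
      gcongr
    have h0 : |y - y'| ≤ 0 := ge_of_tendsto'
      (tendsto_pow_atTop_nhds_zero_of_lt_one (by norm_num) (by norm_num)) hle
    exact h0.trans (by positivity)
  · obtain ⟨n, hn, hmin⟩ : ∃ n, (cantorAddress R c y (n + 1)).1 ≠ (cantorAddress R c y' (n + 1)).1 ∧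
        ∀ i ≤ n, (cantorAddress R c y i).1 = (cantorAddress R c y' i).1 := by
      classical
      push Not at hagree
      obtain ⟨n, hn⟩ : ∃ n, Nat.find hagree = n + 1 :=
        Nat.exists_eq_succ_of_ne_zero fun h0 => Nat.find_spec hagree (by rw [h0]; rfl)
      refine ⟨n, hn ▸ Nat.find_spec hagree, fun i hi => ?_⟩
      by_contra hne
      have := Nat.find_min' hagree hne
      omega
    set N := (childCount R n : ℝ) with hN
    set P := ∏ i ∈ Finset.range n, (childCount R i : ℝ) with hP
    set b := ⌊N * (cantorAddress R c y n).2⌋₊ with hb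
    set b' := ⌊N * (cantorAddress R c y' n).2⌋₊ with hb'
    set d : ℝ := |(b : ℝ) - b'| with hd
    have hN8 : 8 ≤ N := hNpos n
    have hstep : ∀ w, (cantorAddress R c w (n + 1)).1 =
      firstChild R c n (cantorAddress R c w n).1 + ⌊N * (cantorAddress R c w n).2⌋₊ := fun _ => rfl
    have hbb : b ≠ b' := fun heq => hn (by rw [hstep, hstep, hmin n le_rfl, ← hb, ← hb', heq])
    have hd1 : 1 ≤ d := by
      have : (1 : ℤ) ≤ |(b : ℤ) - b'| := Int.one_le_abs (sub_ne_zero.2 (by exact_mod_cast hbb))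
      rw [hd]
      exact_mod_cast this
    have hmem := cantorAddress_snd_mem (R := R) (c := c) hy n
    have hmem' := cantorAddress_snd_mem (R := R) (c := c) hy' n
    have hN8' := (childCount_bounds hR0 hR n).2.2
    have hbN : (b : ℝ) ≤ N := 
      Nat.cast_le.2 (digit_lt (by omega : 0 < childCount R n) hmem).le
    have hbN' : (b' : ℝ) ≤ N := 
      Nat.cast_le.2 (digit_lt (by omega : 0 < childCount R n) hmem').le
    have hdN : d ≤ N := by
      rw [hd, abs_le]
      constructor <;> linarith [b.cast_nonneg (α := ℝ), b'.cast_nonneg (α := ℝ)]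
    have hrem : |(cantorAddress R c y n).2 - (cantorAddress R c y' n).2| ≤ 2 * (d / N) := by
      have h1 := Nat.floor_le (mul_nonneg (by linarith : 0 ≤ N) hmem.1)
      have h2 := Nat.lt_floor_add_one (N * (cantorAddress R c y n).2)
      have h1' := Nat.floor_le (mul_nonneg (by linarith : 0 ≤ N) hmem'.1)
      have h2' := Nat.lt_floor_add_one (N * (cantorAddress R c y' n).2)
      rw [← hb] at h1 h2
      rw [← hb'] at h1' h2'
      have h3 : |N * (cantorAddress R c y n).2 - N * (cantorAddress R c y' n).2| ≤ d + 1 := by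
        have h4 := le_abs_self ((b : ℝ) - b')
        have h5 := neg_abs_le ((b : ℝ) - b')
        rw [abs_le]; constructor <;> linarith
      rw [← mul_sub, abs_mul, abs_of_nonneg (by linarith : 0 ≤ N)] at h3
      rw [← mul_div_assoc, le_div_iff₀ (by linarith)]
      linarith
    have hdist : d / N ≤ 24 * R n * |cantorPoint R c y - cantorPoint R c y'| := by
      have h1 := cantorPoint_mem hc hR0 hR hy (n + 1)
      have h2 := cantorPoint_mem hc hR0 hR hy' (n + 1)
      rw [hstep, ← hb] at h1
      rw [hstep, ← hb', ← hmin n le_rfl] at h2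
      push_cast at h1 h2
      have h3 : d / 2 ≤ |cantorPoint R c y * R (n + 1) - cantorPoint R c y' * R (n + 1)| := by
        have h4 := abs_sub_abs_le_abs_sub ((b : ℝ) - b')
          (((b : ℝ) - b') - (cantorPoint R c y * R (n + 1) - cantorPoint R c y' * R (n + 1)))
        rw [sub_sub_cancel, ← hd] at h4
        have h5 : |((b : ℝ) - b') - (cantorPoint R c y * R (n + 1) -
            cantorPoint R c y' * R (n + 1))| ≤ 1 / 6 := by
          rw [abs_le]; constructor <;> linarith
        linarith
      rw [← sub_mul, abs_mul, abs_of_pos (hR0 (n + 1))] at h3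
      have h6 := (childCount_bounds hR0 hR n).1
      rw [← hN, div_div, div_le_iff₀ (by have := hR0 n; positivity)] at h6
      rw [div_le_iff₀ (by linarith)]
      nlinarith [abs_nonneg (cantorPoint R c y - cantorPoint R c y')]
    have hpow : d / N ≤ 24 ^ s * R n ^ s * |cantorPoint R c y - cantorPoint R c y'| ^ s := by
      have hn0 := (hR0 n).le
      calc d / N ≤ (d / N) ^ s := Real.self_le_rpow_of_le_one (by positivity)
            ((div_le_one (by linarith)).2 hdN) hs1.le
        _ ≤ (24 * R n * |cantorPoint R c y - cantorPoint R c y'|) ^ s := by gcongr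
        _ = _ := by
          rw [Real.mul_rpow (by positivity) (abs_nonneg _), Real.mul_rpow (by norm_num) hn0]
    have hsize : R n ^ s / P ≤ R 0 * Real.exp (9 / (4 * (1 - s))) := by
      have h1 := pow_mul_rpow_le hexp hs1 n
      have h2 := le_prod_childCount hR0 hR n
      rw [← hP] at h2
      rw [div_le_iff₀ (hprodpos n)]
      have h3 : 12 ^ n * R n ^ s ≤ 12 ^ n * (R 0 * Real.exp (9 / (4 * (1 - s))) * P) := by
        calc _ ≤ _ := h1
          _ ≤ Real.exp (9 / (4 * (1 - s))) * (R 0 * 12 ^ n * P) := by gcongr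
          _ = _ := by ring
      exact le_of_mul_le_mul_left h3 (by positivity)
    rw [sub_eq_div_of_agree hR0 hR hy hy' n hmin, abs_div, abs_of_pos (hprodpos n)]
    calc _ ≤ 2 * (24 ^ s * R n ^ s * |cantorPoint R c y - cantorPoint R c y'| ^ s) / P :=
          div_le_div_of_nonneg_right (hrem.trans (mul_le_mul_of_nonneg_left hpow zero_le_two))
            (hprodpos n).le
      _ = 2 * 24 ^ s * (R n ^ s / P) * |cantorPoint R c y - cantorPoint R c y'| ^ s := by ring
      _ ≤ 2 * 24 ^ s * (R 0 * Real.exp (9 / (4 * (1 - s)))) *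
          |cantorPoint R c y - cantorPoint R c y'| ^ s := by gcongr
      _ = _ := by ring

end Cantor

/-! ### The sets `F` -/

lemma unitInterval4_eq (sm sp : Bool) :
    ∃ c : ℝ, 0 ≤ c ∧ c ≤ 3 / 4 ∧ unitInterval4 sm sp = Icc (c - 1 / 12) (c + 1 / 12) := by
  rcases sm with _ | _ <;> rcases sp with _ | _
  · exact ⟨1 / 2, by norm_num [unitInterval4]⟩
  · exact ⟨1 / 4, by norm_num [unitInterval4]⟩
  · exact ⟨3 / 4, by norm_num [unitInterval4]⟩
  · exact ⟨0, by norm_num [unitInterval4]⟩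

lemma exists_nsmul_eq_of_mem_setF {α : ℝ} {k : ℕ → ℕ} {sm sp : Bool} {x : UnitAddCircle}
    (hx : x ∈ setF α k sm sp) {n N : ℕ} (hn : 1 ≤ n) (hN : freqQ α k n = N) :
    ∃ u ∈ unitInterval4 sm sp, N • x = (u : UnitAddCircle) := by
  obtain ⟨j, hj, u, hu, rfl⟩ := hx n hn
  refine ⟨u, hu, ?_⟩
  have hpos : (0 : ℝ) < N := by rw [← hN]; exact lt_of_le_of_lt j.cast_nonneg hj
  have hN0 : (N : ℝ) ≠ 0 := hpos.ne'
  rw [hN, ← AddCircle.coe_nsmul, nsmul_eq_mul, mul_div_cancel₀ _ hN0, AddCircle.coe_add,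
    add_eq_left, AddCircle.coe_eq_zero_iff]
  exact ⟨j, by simp⟩

lemma FastIndices.exists_param_setF {α : ℝ} (hα : Irrational α) {k : ℕ → ℕ}
    (hk : FastIndices α k) (sm sp : Bool) :
    ∃ g : ℝ → UnitAddCircle, (∀ y ∈ Ico (0 : ℝ) 1, g y ∈ setF α k sm sp) ∧
      ∀ s : ℝ, 0 < s → s < 1 → ∃ K : ℝ, ∀ y ∈ Ico (0 : ℝ) 1, ∀ y' ∈ Ico (0 : ℝ) 1,
        |y - y'| ≤ K * dist (g y) (g y') ^ s := by
  obtain ⟨c, hc0, hc1, hI⟩ := unitInterval4_eq sm sp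
  set R : ℕ → ℝ := fun n => freqQ α k (n + 1) with hRdef
  have hR : ∀ n, 100 * R n ≤ R (n + 1) := fun n => hk.freqQ_growth hα (n + 1)
  have hbig : ∀ n : ℕ, 1000 * Real.exp ((n : ℝ) ^ 2) ≤ R n := fun n => by
    refine le_trans ?_ (hk.exp_sq_le_freqQ hα (n + 1))
    gcongr
    linarith
  have hexp : ∀ n : ℕ, Real.exp ((n : ℝ) ^ 2) ≤ R n := fun n => by
    linarith [hbig n, Real.exp_pos ((n : ℝ) ^ 2)]
  have hR1000 : ∀ n : ℕ, 1000 ≤ R n := fun n => by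
    linarith [hbig n, Real.one_le_exp (sq_nonneg (n : ℝ))]
  have hR0 : ∀ n, 0 < R n := fun n => by linarith [hR1000 n]
  have hfirst : ∀ y ∈ Ico (0 : ℝ) 1,
      0 ≤ cantorPoint R c y ∧ cantorPoint R c y ≤ 1 / 500 := fun y hy => by
    have h := cantorPoint_mem hc0 hR0 hR hy 0
    simp only [cantorAddress, Nat.cast_one] at h
    have h0 := hR1000 0
    constructor <;> nlinarith [h.1, h.2]
  -- as the Cantor set lies in `[0, 1 / 500]`, the projection to the circle is isometric on it
  refine ⟨fun y => (cantorPoint R c y : UnitAddCircle), fun y hy n hn => ?_, fun s hs0 hs1 => ?_⟩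
  · obtain ⟨i, rfl⟩ : ∃ i, n = i + 1 := ⟨n - 1, by omega⟩
    have h := cantorPoint_mem hc0 hR0 hR hy i
    have hR1 := hR1000 i
    refine ⟨(cantorAddress R c y i).1, ?_,
      cantorPoint R c y * R i - (cantorAddress R c y i).1, ?_, ?_⟩
    · change _ < R i
      nlinarith [h.1, (hfirst y hy).2]
    · rw [hI]
      constructor <;> linarith [h.1, h.2]
    · rw [sub_add_cancel]
      change _ = ((cantorPoint R c y * R i / R i : ℝ) : UnitAddCircle)
      rw [mul_div_cancel_right₀ _ (hR0 i).ne']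
  · obtain ⟨K, hK⟩ := exists_cantorPoint_bound hc0 hR hexp hs0 hs1
    refine ⟨K, fun y hy y' hy' => ?_⟩
    have hd : dist (cantorPoint R c y : UnitAddCircle) (cantorPoint R c y') =
        |cantorPoint R c y - cantorPoint R c y'| := by
      rw [dist_eq_norm, ← AddCircle.coe_sub]
      refine (AddCircle.norm_coe_eq_abs_iff 1 one_ne_zero).2 ?_
      rw [abs_one, abs_le]
      constructor <;> linarith [(hfirst y hy).1, (hfirst y hy).2, (hfirst y' hy').1,
        (hfirst y' hy').2]
    rw [hd]
    exact hK y hy y' hy'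

lemma FastIndices.le_dimH_setF {α : ℝ} (hα : Irrational α) {k : ℕ → ℕ} (hk : FastIndices α k)
    (sm sp : Bool) :
    1 ≤ dimH (setF α k sm sp) ∧ 2 ≤ dimH (setF α k sm sp ×ˢ (univ : Set ℝ)) := by
  obtain ⟨g, hgA, hg⟩ := hk.exists_param_setF hα sm sp
  exact le_dimH_of_holder_inverse hgA hg

lemma FastIndices.setF_nonempty {α : ℝ} (hα : Irrational α) {k : ℕ → ℕ} (hk : FastIndices α k)
    (sm sp : Bool) : (setF α k sm sp).Nonempty := by
  obtain ⟨g, hgA, -⟩ := hk.exists_param_setF hα sm sp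
  exact ⟨g 0, hgA 0 ⟨le_rfl, one_pos⟩⟩

lemma FastIndices.divergenceSign_eq {α : ℝ} {k : ℕ → ℕ} (hk : FastIndices α k) (sm sp s : Bool) :
    divergenceSign k sm sp s = signVal s := by
  simp [divergenceSign, (hk.even 1).neg_one_pow]

/-- Divergence in all four sign patterns, reduced to the minima and the rising slopes: a half-turn
exchanges maxima and minima, and a reflection exchanges rising and falling slopes. -/
lemma BlockScales.le_signVal_mul {h θ : ℕ → ℝ} (hs : BlockScales h θ) {z : ℕ → UnitAddCircle}
    {sm sp : Bool} (hz : ∀ n, 1 ≤ n → ∃ u ∈ unitInterval4 sm sp, z n = (u : UnitAddCircle))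
    (C : ℝ) :
    ∃ M : ℝ, ∀ m S : ℝ,
      HasSum (fun n => h n * (profile (z n + ((m * θ n : ℝ) : UnitAddCircle)) - profile (z n))) S →
      (M ≤ m → C ≤ signVal sp * S) ∧ (m ≤ -M → C ≤ signVal sm * S) := by
  rcases sm with _ | _ <;> rcases sp with _ | _
  · have hz' : ∀ n, 1 ≤ n → ∃ u : ℝ, |u| ≤ 1 / 12 ∧
        z n + ((1 / 2 : ℝ) : UnitAddCircle) = (u : UnitAddCircle) := fun n hn => by
      obtain ⟨u, hu, hzu⟩ := hz n hn
      refine ⟨u + 1 / 2 - 1, ?_, by rw [coe_sub_one, AddCircle.coe_add, hzu]⟩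
      rw [abs_le]
      constructor <;> linarith [hu.1, hu.2]
    obtain ⟨M, hM⟩ := hs.le_of_hasSum_at_min hz' C
    refine ⟨M, fun m S hS => ?_⟩
    have key : M ≤ |m| → C ≤ signVal false * S := fun hm => by
      refine hM m _ hm ((hS.mul_left (signVal false)).congr_fun fun n => ?_)
      rw [add_right_comm, profile_add_half, profile_add_half]
      simp only [signVal, Bool.false_eq_true, if_false]
      ring
    exact ⟨fun hm => key (hm.trans (le_abs_self m)),
      fun hm => key ((le_neg_of_le_neg hm).trans (neg_le_abs m))⟩
  · obtain ⟨M, hM⟩ := hs.le_of_hasSum_at_slope (z := z) (fun n hn => by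
      obtain ⟨u, hu, hzu⟩ := hz n hn
      exact ⟨u, hu.1, hu.2, hzu⟩) C
    refine ⟨M, fun m S hS => ⟨fun hm => ?_, fun hm => ?_⟩⟩
    · have := hM m 1 S hm (by simp) (by simpa only [one_mul] using hS)
      simpa [signVal] using this
    · have := hM (-m) (-1) S (by linarith) (by simp) (by simpa only [neg_one_mul, neg_neg] using hS)
      simpa [signVal] using this
  · obtain ⟨M, hM⟩ := hs.le_of_hasSum_at_slope (z := fun n => -z n) (fun n hn => by
      obtain ⟨u, hu, hzu⟩ := hz n hn
      refine ⟨1 - u, by linarith [hu.2], by linarith [hu.1], ?_⟩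
      rw [hzu, AddCircle.coe_sub, AddCircle.coe_period, zero_sub]) C
    have hrefl : ∀ m S : ℝ,
        HasSum (fun n => h n * (profile (z n + ((m * θ n : ℝ) : UnitAddCircle)) -
          profile (z n))) S →
        HasSum (fun n => h n * (profile (-z n + ((-m * θ n : ℝ) : UnitAddCircle)) -
          profile (-z n))) S := fun m S hS => hS.congr_fun fun n => by
      rw [neg_mul, AddCircle.coe_neg, ← neg_add, profile_neg, profile_neg]
    refine ⟨M, fun m S hS => ⟨fun hm => ?_, fun hm => ?_⟩⟩
    · have := hM m (-1) S hm (by simp) (by simpa only [neg_one_mul] using hrefl m S hS)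
      simpa [signVal] using this
    · have := hM (-m) 1 S (by linarith) (by simp) (by simpa only [one_mul] using hrefl m S hS)
      simpa [signVal] using this
  · obtain ⟨M, hM⟩ := hs.le_of_hasSum_at_min (z := z) (fun n hn => by
      obtain ⟨u, hu, hzu⟩ := hz n hn
      exact ⟨u, abs_le.2 ⟨by linarith [hu.1], hu.2⟩, hzu⟩) C
    refine ⟨M, fun m S hS => ?_⟩
    have key : M ≤ |m| → C ≤ signVal true * S := fun hm => by
      simpa [signVal] using hM m S hm hS
    exact ⟨fun hm => key (hm.trans (le_abs_self m)),
      fun hm => key ((le_neg_of_le_neg hm).trans (neg_le_abs m))⟩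

/-! ### The function `f` -/

lemma exists_zsmul_norm_lt {α : ℝ} (hα : Irrational α) {η : ℝ} (M : ℤ) (hη : 0 < η) :
    ∃ m : ℤ, M ≤ m ∧ ‖m • (α : UnitAddCircle)‖ < η := by
  obtain ⟨n, hn, -, hC⟩ := exists_even_index hα 0 (max M (1 / η + 1))
  obtain ⟨p, q, hq, hlo, hhi⟩ := exists_convergent_of_even hα hn
  have h1 := one_le_cfDen hα (n + 1)
  refine ⟨q, ?_, ?_⟩
  · have : (M : ℝ) ≤ q := hq ▸ (le_max_left _ _).trans hC
    exact_mod_cast this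
  · have hp : ((p : ℝ) : UnitAddCircle) = 0 := (AddCircle.coe_eq_zero_iff 1).2 ⟨p, by simp⟩
    have heq : (q : ℤ) • (α : UnitAddCircle) = ((α * q - p : ℝ) : UnitAddCircle) := by
      rw [AddCircle.coe_sub, hp, sub_zero, natCast_zsmul, ← AddCircle.coe_nsmul, nsmul_eq_mul,
        mul_comm]
    rw [heq]
    have h2 : 1 / η + 1 ≤ cfDen α (n + 1) :=
      ((le_max_right _ _).trans hC).trans (cfDen_mono α n.le_succ)
    calc ‖((α * q - p : ℝ) : UnitAddCircle)‖ ≤ |α * q - p| := QuotientAddGroup.norm_mk_le_norm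
      _ = α * q - p := abs_of_nonneg (le_trans (by positivity) hlo)
      _ ≤ 1 / cfDen α (n + 1) := hhi
      _ < 1 / (1 / η) := one_div_lt_one_div_of_lt (by positivity) (by linarith)
      _ = η := one_div_one_div η

lemma denseRange_zsmul_of_irrational {α : ℝ} (hα : Irrational α) :
    DenseRange fun m : ℤ => m • (α : UnitAddCircle) :=
  AddCircle.denseRange_zsmul_coe_iff.2 (by simpa using hα)

/-- The building block of height `h / 3` and frequency `Q`, as a function on the circle. -/
def circleBlock (h : ℝ) (Q : ℕ) : C(UnitAddCircle, ℝ) :=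
  ⟨fun x => h * profile (Q • x), by fun_prop⟩

/-- The coboundary of `B` over the rotation by `a`. -/
def coboundary (a : UnitAddCircle) (B : C(UnitAddCircle, ℝ)) : C(UnitAddCircle, ℝ) :=
  ⟨fun x => B (x + a) - B x, by fun_prop⟩

lemma blockFun_eq_circleBlock {α : ℝ} {k : ℕ → ℕ} {n Q : ℕ} (hQ : freqQ α k n = Q)
    (hpos : 0 < freqQ α k n) (x : ℝ) :
    blockFun α k n x = circleBlock (lipL α k n / freqQ α k n) Q (x : UnitAddCircle) := by
  rw [blockFun, trapezoid_eq_profile _ hpos, circleBlock, ContinuousMap.coe_mk,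
    ← AddCircle.coe_nsmul, nsmul_eq_mul, hQ]

section Series

variable {a : UnitAddCircle} {h θ : ℕ → ℝ} {Q : ℕ → ℕ}

lemma BlockScales.summable_coboundary (hs : BlockScales h θ)
    (hQ : ∀ n, Q n • a = (θ n : UnitAddCircle)) :
    Summable fun n => coboundary a (circleBlock (h n) (Q n)) := by
  refine Summable.of_norm_bounded (g := fun n : ℕ => 1 / (n : ℝ) ^ 2)
    (Real.summable_one_div_nat_pow.2 one_lt_two) fun n => ?_
  rw [ContinuousMap.norm_le _ (by positivity)]
  intro x
  change ‖h n * profile (Q n • (x + a)) - h n * profile (Q n • x)‖ ≤ _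
  rw [← mul_sub, norm_mul, Real.norm_of_nonneg (hs.h_nonneg n)]
  calc h n * ‖profile (Q n • (x + a)) - profile (Q n • x)‖ ≤ h n * θ n := by
        refine mul_le_mul_of_nonneg_left ?_ (hs.h_nonneg n)
        refine (abs_profile_sub_le _ _).trans ?_
        rw [nsmul_add, add_sub_cancel_left, hQ]
        exact QuotientAddGroup.norm_mk_le_norm.trans (abs_of_nonneg (hs.θ_nonneg n)).le
    _ ≤ _ := hs.step_upper n

lemma hasSum_ergodicSum_blocks (hQ : ∀ n, Q n • a = (θ n : UnitAddCircle))
    {f : C(UnitAddCircle, ℝ)}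
    (hf : HasSum (fun n => coboundary a (circleBlock (h n) (Q n))) f) (m : ℤ) (x : UnitAddCircle) :
    HasSum (fun n => h n * (profile (Q n • x + (((m : ℝ) * θ n : ℝ) : UnitAddCircle)) -
      profile (Q n • x))) (ergodicSum a f m x) := by
  refine (hasSum_ergodicSum (B := fun n => circleBlock (h n) (Q n)) (fun n x => rfl) hf m
    x).congr_fun fun n => ?_
  have : Q n • (x + m • a) = Q n • x + (((m : ℝ) * θ n : ℝ) : UnitAddCircle) := by
    rw [nsmul_add, smul_comm, hQ, ← AddCircle.coe_zsmul, zsmul_eq_mul]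
  simp only [circleBlock, ContinuousMap.coe_mk, this]
  ring

end Series

lemma tendstoUniformly_sum_blockFun {α : ℝ} {k Q : ℕ → ℕ} (hQ : ∀ n, freqQ α k n = Q n)
    (hpos : ∀ n, 0 < freqQ α k n) {f : C(UnitAddCircle, ℝ)}
    (hf : HasSum (fun n => coboundary (α : UnitAddCircle)
      (circleBlock (lipL α k n / freqQ α k n) (Q n))) f) :
    TendstoUniformly (fun (N : ℕ) (x : ℝ) =>
      ∑ n ∈ Finset.Icc 1 N, (blockFun α k n (x + α) - blockFun α k n x))
      (fun x : ℝ => f (x : UnitAddCircle)) atTop := by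
  have h1 := ContinuousMap.tendsto_iff_tendstoUniformly.1
    (hf.tendsto_sum_nat.comp (tendsto_add_atTop_nat 1))
  have h2 := h1.comp ((↑) : ℝ → UnitAddCircle)
  change TendstoUniformly _ (f ∘ ((↑) : ℝ → UnitAddCircle)) atTop
  convert h2 using 1
  ext N x
  simp only [Function.comp_apply, ContinuousMap.coe_sum, Finset.sum_apply]
  have hterm : ∀ n, coboundary (α : UnitAddCircle) (circleBlock (lipL α k n / freqQ α k n) (Q n))
      (x : UnitAddCircle) = blockFun α k n (x + α) - blockFun α k n x := fun n => by
    rw [blockFun_eq_circleBlock (hQ n) (hpos n), blockFun_eq_circleBlock (hQ n) (hpos n),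
      AddCircle.coe_add]
    rfl
  -- the block of index `0` vanishes, as `lipL α k 0` is a division by zero
  have hzero : blockFun α k 0 (x + α) - blockFun α k 0 x = 0 := by
    simp [blockFun_eq_circleBlock (hQ 0) (hpos 0), lipL, circleBlock]
  simp only [hterm]
  rw [Finset.range_eq_Ico, Finset.sum_eq_sum_Ico_succ_bot N.succ_pos, hzero, zero_add]
  rfl

end

theorem mainTheorem1 (α : ℝ) (hα : Irrational α) :
    ∃ f : C(UnitAddCircle, ℝ),
      (∫ x : UnitAddCircle, f x) = 0 ∧
      IsBesicovitch (cylinderMap (α : UnitAddCircle) f) ∧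
      {p : UnitAddCircle × ℝ | HasDiscreteOrbit (cylinderMap (α : UnitAddCircle) f) p} =
        discreteBase (α : UnitAddCircle) f ×ˢ (Set.univ : Set ℝ) ∧
      dimH (discreteBase (α : UnitAddCircle) f ×ˢ (Set.univ : Set ℝ)) = 2 ∧
      ∃ k : ℕ → ℕ, AdmissibleIndices α k ∧
        TendstoUniformly
          (fun (N : ℕ) (x : ℝ) =>
            ∑ n ∈ Finset.Icc 1 N, (blockFun α k n (x + α) - blockFun α k n x))
          (fun x : ℝ => f (x : UnitAddCircle)) atTop ∧
        ∀ sm sp : Bool,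
          setF α k sm sp ⊆ discreteBase (α : UnitAddCircle) f ∧
          dimH (setF α k sm sp) = 1 ∧
          ∀ x ∈ setF α k sm sp,
            Tendsto (fun m : ℤ => divergenceSign k sm sp sp *
              ergodicSum (α : UnitAddCircle) f m x) atTop atTop ∧
            Tendsto (fun m : ℤ => divergenceSign k sm sp sm *
              ergodicSum (α : UnitAddCircle) f m x) atBot atTop := by
  obtain ⟨k, hk⟩ := exists_fastIndices hα
  obtain ⟨Q, θ, hQ, hQθ, hs⟩ := hk.exists_scales hα
  have hpos : ∀ n, 0 < freqQ α k n := fun n =>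
    lt_of_lt_of_le (by positivity) (hk.exp_sq_le_freqQ hα n)
  obtain ⟨f, hf⟩ := hs.summable_coboundary hQθ
  have hdiv : ∀ sm sp, ∀ x ∈ setF α k sm sp,
      Tendsto (fun m : ℤ => signVal sp * ergodicSum (α : UnitAddCircle) f m x) atTop atTop ∧
      Tendsto (fun m : ℤ => signVal sm * ergodicSum (α : UnitAddCircle) f m x) atBot atTop := by
    intro sm sp x hx
    have hC := hs.le_signVal_mul (z := fun n => Q n • x) (sm := sm) (sp := sp)
      fun n hn => exists_nsmul_eq_of_mem_setF hx hn (hQ n)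
    constructor
    · refine tendsto_atTop.2 fun C => ?_
      obtain ⟨M, hM⟩ := hC C
      filter_upwards [tendsto_intCast_atTop_atTop.eventually_ge_atTop M] with m hm
      exact (hM m _ (hasSum_ergodicSum_blocks hQθ hf m x)).1 hm
    · refine tendsto_atTop.2 fun C => ?_
      obtain ⟨M, hM⟩ := hC C
      filter_upwards [eventually_le_atBot (-⌈M⌉)] with m hm
      refine (hM m _ (hasSum_ergodicSum_blocks hQθ hf m x)).2 ?_
      have : (m : ℝ) ≤ -(⌈M⌉ : ℝ) := by exact_mod_cast hm
      linarith [Int.le_ceil M]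
  have hsub : ∀ sm sp, setF α k sm sp ⊆ discreteBase (α : UnitAddCircle) f := by
    intro sm sp x hx
    refine hasDiscreteOrbit_of_tendsto ?_
    have hle : ∀ (s : Bool) (r : ℝ), signVal s * r ≤ |r| := by
      intro s r
      rcases s with _ | _
      · simpa [signVal] using neg_le_abs r
      · simpa [signVal] using le_abs_self r
    obtain ⟨h1, h2⟩ := hdiv sm sp x hx
    rw [Int.cofinite_eq]
    exact (tendsto_atTop_mono (fun m => hle _ _) h2).sup (tendsto_atTop_mono (fun m => hle _ _) h1)
  have htrans : IsTransitiveHomeo (cylinderMap (α : UnitAddCircle) f) := by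
    refine isTransitiveHomeo_cylinderMap (denseRange_zsmul_of_irrational hα)
      (fun η M hη => exists_zsmul_norm_lt hα M hη) fun C => ?_
    obtain ⟨x, hx⟩ := hk.setF_nonempty hα false false
    obtain ⟨y, hy⟩ := hk.setF_nonempty hα true true
    filter_upwards [(hdiv _ _ x hx).1.eventually_ge_atTop C,
      (hdiv _ _ y hy).1.eventually_ge_atTop C] with m h1 h2
    refine ⟨x, y, ?_, by simpa [signVal] using h2⟩
    have : C ≤ -ergodicSum (α : UnitAddCircle) f m x := by simpa [signVal] using h1
    linarith
  refine ⟨f, integral_eq_zero_of_hasSum hf fun n => integral_coboundary _, ⟨htrans, ?_⟩,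
    setOf_hasDiscreteOrbit _ _, ?_, k, hk.admissible hα,
    tendstoUniformly_sum_blockFun hQ hpos hf, fun sm sp => ⟨hsub sm sp, ?_, ?_⟩⟩
  · obtain ⟨x, hx⟩ := hk.setF_nonempty hα true true
    exact ⟨(x, 0), hsub _ _ hx 0⟩
  · exact le_antisymm (dimH_unitAddCircle_prod_le _) ((hk.le_dimH_setF hα true true).2.trans
      (dimH_mono (prod_mono (hsub true true) Subset.rfl)))
  · exact le_antisymm (dimH_unitAddCircle_le _) (hk.le_dimH_setF hα sm sp).1
  · intro x hx
    rw [hk.divergenceSign_eq, hk.divergenceSign_eq]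
    exact hdiv sm sp x hx
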